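/- Let $n\ge 0$ be an integer, $\lambda_0\in L^\infty(0,1;\mathbb{R})$ with $\lambda_0\ge\epsilon$ a.e. on $(0,1)$ for some $\epsilon>0$, $M\in L^\infty(0,1;\mathbb{C}^{n\times n})$ and $K,L\in\mathbb{C}^{n\times n}$. Let $X=L^2(0,1;\mathbb{C}^n)$ with the inner product $\langle f,g\rangle_X=\int_0^1\lambda_0(\zeta)\,g(\zeta)^*f(\zeta)\,d\zeta$, and let $P:[0,1]\to\mathbb{C}^{n\times n}$ be the (Carathéodory) solution of $$P'(\zeta)=\lambda_0(\zeta)^{-1}M(\zeta)P(\zeta),\qquad P(0)=I,$$ i.e. the continuous solution of the integrated equation. Let $\mathfrak{A}$ be the unbounded operator on $X$ given by $$\mathfrak{A}g=-\frac{d}{d\zeta}(\lambda_0 g),\qquad D(\mathfrak{A})=\{g\in X \mid \lambda_0 g\in H^1(0,1;\mathbb{C}^n),\ K(\lambda_0 g)(0)+LP(1)(\lambda_0 g)(1)=0\},$$ where $(\lambda_0 g)(0)$ and $(\lambda_0 g)(1)$ are the values at $0$ and $1$ of the absolutely continuous representative of $\lambda_0 g$. Suppose that $\mathfrak{A}$ is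 the infinitesimal generator of a $C_0$-semigroup $(T(t))_{t\ge0}$ on $X$. Then $(T(t))_{t\ge 0}$ extends to a $C_0$-group on $X$, i.e. there is a $C_0$-group $(G(t))_{t\in\mathbb{R}}$ on $X$ with $G(t)=T(t)$ for all $t\ge 0$, if and only if $L$ is invertible. -/

import Mathlib

open MeasureTheory Set Filter Topology
open scoped NNReal ENNReal

noncomputable section

/-! ### Strongly continuous semigroups and groups -/

/-- A `C₀`-semigroup of bounded linear operators on a normed space `X`. -/
structure C0Semigroup (X : Type*) [NormedAddCommGroup X] [NormedSpace ℂ X] where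
  op : ℝ≥0 → X →L[ℂ] X
  op_zero : op 0 = ContinuousLinearMap.id ℂ X
  op_add : ∀ s t, op (s + t) = (op s).comp (op t)
  tendsto_zero : ∀ x, Tendsto (fun t => op t x) (𝓝 0) (𝓝 x)

/-- A `C₀`-group of bounded linear operators on a normed space `X`. -/
structure C0Group (X : Type*) [NormedAddCommGroup X] [NormedSpace ℂ X] where
  op : ℝ → X →L[ℂ] X
  op_zero : op 0 = ContinuousLinearMap.id ℂ X
  op_add : ∀ s t, op (s + t) = (op s).comp (op t)
  tendsto_zero : ∀ x, Tendsto (fun t => op t x) (𝓝 0) (𝓝 x)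

namespace C0Semigroup

variable {X : Type*} [NormedAddCommGroup X] [NormedSpace ℂ X]

/-- The difference quotient `(T(t) x - x) / t`. -/
def quotient (T : C0Semigroup X) (x : X) (t : ℝ≥0) : X := (((t : ℝ) : ℂ)⁻¹) • (T.op t x - x)

/-- The graph of the infinitesimal generator: the pairs `(x, y)` such that
`(T(t) x - x) / t → y` as `t → 0+`. -/
def generatorGraph (T : C0Semigroup X) : Submodule ℂ (X × X) where
  carrier := {p | Tendsto (T.quotient p.1) (𝓝[>] 0) (𝓝 p.2)}
  zero_mem' := by
    simp only [mem_ofPred_eq, Prod.fst_zero, Prod.snd_zero]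
    refine tendsto_const_nhds.congr fun t => ?_
    simp [quotient]
  add_mem' := by
    intro p q hp hq
    simp only [mem_ofPred_eq] at hp hq ⊢
    refine (hp.add hq).congr fun t => ?_
    simp only [quotient, Prod.fst_add, map_add, ← smul_add]
    congr 1
    abel
  smul_mem' := by
    intro c p hp
    simp only [mem_ofPred_eq] at hp ⊢
    refine (hp.const_smul c).congr fun t => ?_
    simp only [quotient, Prod.smul_fst, map_smul, ← smul_sub]
    rw [smul_comm]

/-- The infinitesimal generator, as an unbounded operator. -/
def generator (T : C0Semigroup X) : X →ₗ.[ℂ] X := T.generatorGraph.toLinearPMap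

theorem mem_graph_generator (T : C0Semigroup X) (x y : X) :
    (x, y) ∈ T.generator.graph ↔ Tendsto (T.quotient x) (𝓝[>] 0) (𝓝 y) := by
  rw [generator, Submodule.toLinearPMap_graph_eq]
  · rfl
  · rintro ⟨a, b⟩ h h0
    change a = 0 at h0
    change Tendsto (T.quotient a) (𝓝[>] 0) (𝓝 b) at h
    subst h0
    refine tendsto_nhds_unique h (tendsto_const_nhds.congr fun t => ?_)
    simp [quotient]

/-- The semigroup `(T(t))_{t ≥ 0}` extends to a `C₀`-group `(G(t))_{t ∈ ℝ}`. -/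
def ExtendsToGroup (T : C0Semigroup X) : Prop :=
  ∃ G : C0Group X, ∀ t : ℝ≥0, G.op (t : ℝ) = T.op t

end C0Semigroup

/-! ### The coefficients, the state space and the operator -/

/-- Lebesgue measure on the interval `(0, 1)`. -/
abbrev unitVolume : Measure ℝ := volume.restrict (Ioo (0 : ℝ) 1)

/-- The scalar coefficient: `lam ∈ L^∞(0,1;ℝ)` with `lam ≥ ε > 0` almost everywhere. -/
structure IsAdmissibleSpeed (lam : ℝ → ℝ) : Prop where
  memLp : MemLp lam ∞ unitVolume
  bound : ∃ ε : ℝ, 0 < ε ∧ ∀ᵐ ζ ∂unitVolume, ε ≤ lam ζ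

/-- The measure `lam(ζ) dζ` on `(0, 1)`. -/
def weightMeasure (lam : ℝ → ℝ) : Measure ℝ :=
  unitVolume.withDensity fun ζ => ENNReal.ofReal (lam ζ)

/-- The state space `X = L²(0,1;ℂⁿ)` with the inner product `∫₀¹ lam(ζ) g(ζ)^* f(ζ) dζ`. -/
abbrev StateSpace (n : ℕ) (lam : ℝ → ℝ) : Type :=
  Lp (EuclideanSpace ℂ (Fin n)) 2 (weightMeasure lam)

/-- `u` on `[0,1]` is the absolutely continuous representative of an element of
`H¹(0,1;ℂⁿ)` with derivative `v ∈ L²(0,1;ℂⁿ)`. -/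
structure IsH1 {n : ℕ} (u v : ℝ → EuclideanSpace ℂ (Fin n)) : Prop where
  memLp : MemLp v 2 unitVolume
  eq_integral : ∀ ζ ∈ Icc (0 : ℝ) 1, u ζ = u 0 + ∫ s in (0 : ℝ)..ζ, v s

/-- `P` solves `P'(ζ) = lam(ζ)⁻¹ M(ζ) P(ζ)`, `P(0) = I` on `[0,1]` in the sense of
Carathéodory, that is, `P` is continuous and satisfies the integrated equation (entrywise). -/
structure IsFundamentalSolution {n : ℕ} (lam : ℝ → ℝ) (M P : ℝ → Matrix (Fin n) (Fin n) ℂ) :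
    Prop where
  continuousOn : ContinuousOn P (Icc 0 1)
  eq_integral : ∀ ζ ∈ Icc (0 : ℝ) 1, ∀ i j, P ζ i j =
    (1 : Matrix (Fin n) (Fin n) ℂ) i j +
      ∫ s in (0 : ℝ)..ζ, ((lam s : ℂ))⁻¹ * (M s * P s) i j

namespace IsH1

variable {n : ℕ} {u v u' v' : ℝ → EuclideanSpace ℂ (Fin n)}

theorem intervalIntegrable (h : IsH1 u v) {ζ : ℝ} (hζ : ζ ∈ Icc (0 : ℝ) 1) :
    IntervalIntegrable v volume 0 ζ := by
  have h1 : Integrable v unitVolume := h.memLp.integrable (by norm_num)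
  have h2 : IntegrableOn v (Ioc 0 1) volume := by
    rw [integrableOn_Ioc_iff_integrableOn_Ioo]; exact h1
  rw [intervalIntegrable_iff_integrableOn_Ioc_of_le hζ.1]
  exact h2.mono_set (Ioc_subset_Ioc_right hζ.2)

theorem zero : IsH1 (0 : ℝ → EuclideanSpace ℂ (Fin n)) 0 :=
  ⟨MemLp.zero, fun ζ _ => by simp⟩

theorem add (h : IsH1 u v) (h' : IsH1 u' v') : IsH1 (u + u') (v + v') := by
  refine ⟨h.memLp.add h'.memLp, fun ζ hζ => ?_⟩
  simp only [Pi.add_apply]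
  rw [intervalIntegral.integral_add (h.intervalIntegrable hζ) (h'.intervalIntegrable hζ),
    h.eq_integral ζ hζ, h'.eq_integral ζ hζ]
  abel

theorem smul (c : ℂ) (h : IsH1 u v) : IsH1 (c • u) (c • v) := by
  refine ⟨h.memLp.const_smul c, fun ζ hζ => ?_⟩
  simp only [Pi.smul_apply]
  rw [intervalIntegral.integral_smul, h.eq_integral ζ hζ, smul_add]

end IsH1

/-- The graph of the operator `f ↦ -(lam f)'` with domain
`{f ∈ X | lam f ∈ H¹(0,1;ℂⁿ), W₀ (lam f)(0) + W₁ (lam f)(1) = 0}`; the boundary values are those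
of the absolutely continuous representative `u` of `lam f`. -/
def transportGraph {n : ℕ} (lam : ℝ → ℝ) (W₀ W₁ : Matrix (Fin n) (Fin n) ℂ) :
    Submodule ℂ (StateSpace n lam × StateSpace n lam) where
  carrier := {p | ∃ u v : ℝ → EuclideanSpace ℂ (Fin n), IsH1 u v ∧
    (∀ᵐ ζ ∂weightMeasure lam, (lam ζ : ℂ) • p.1 ζ = u ζ) ∧
    (∀ᵐ ζ ∂weightMeasure lam, p.2 ζ = - v ζ) ∧
    W₀.mulVec (u 0).ofLp + W₁.mulVec (u 1).ofLp = 0}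
  zero_mem' := by
    refine ⟨0, 0, IsH1.zero, ?_, ?_, by simp⟩
    · filter_upwards [Lp.coeFn_zero (EuclideanSpace ℂ (Fin n)) 2 (weightMeasure lam)] with ζ hζ
      rw [Prod.fst_zero, hζ]
      simp
    · filter_upwards [Lp.coeFn_zero (EuclideanSpace ℂ (Fin n)) 2 (weightMeasure lam)] with ζ hζ
      rw [Prod.snd_zero, hζ]
      simp
  add_mem' := by
    rintro p q ⟨u, v, h, hu, hv, hb⟩ ⟨u', v', h', hu', hv', hb'⟩
    refine ⟨u + u', v + v', h.add h', ?_, ?_, ?_⟩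
    · filter_upwards [hu, hu', Lp.coeFn_add p.1 q.1] with ζ h1 h2 h3
      rw [Prod.fst_add, h3, Pi.add_apply, Pi.add_apply, smul_add, h1, h2]
    · filter_upwards [hv, hv', Lp.coeFn_add p.2 q.2] with ζ h1 h2 h3
      rw [Prod.snd_add, h3, Pi.add_apply, h1, h2, Pi.add_apply, neg_add]
    · calc _ = (W₀.mulVec (u 0).ofLp + W₁.mulVec (u 1).ofLp)
            + (W₀.mulVec (u' 0).ofLp + W₁.mulVec (u' 1).ofLp) := by
            simp only [Pi.add_apply, WithLp.ofLp_add, Matrix.mulVec_add]; abel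
        _ = 0 := by rw [hb, hb', add_zero]
  smul_mem' := by
    rintro c p ⟨u, v, h, hu, hv, hb⟩
    refine ⟨c • u, c • v, h.smul c, ?_, ?_, ?_⟩
    · filter_upwards [hu, Lp.coeFn_smul c p.1] with ζ h1 h3
      rw [Prod.smul_fst, h3, Pi.smul_apply, Pi.smul_apply, ← h1, smul_comm]
    · filter_upwards [hv, Lp.coeFn_smul c p.2] with ζ h1 h3
      rw [Prod.smul_snd, h3, Pi.smul_apply, Pi.smul_apply, h1, smul_neg]
    · simp only [Pi.smul_apply, WithLp.ofLp_smul, Matrix.mulVec_smul, ← smul_add, hb, smul_zero]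

/-- The unbounded operator `f ↦ -(lam f)'` on `X` with domain
`{f ∈ X | lam f ∈ H¹(0,1;ℂⁿ), W₀ (lam f)(0) + W₁ (lam f)(1) = 0}`. -/
def transportOperator {n : ℕ} (lam : ℝ → ℝ) (W₀ W₁ : Matrix (Fin n) (Fin n) ℂ) :
    StateSpace n lam →ₗ.[ℂ] StateSpace n lam :=
  (transportGraph lam W₀ W₁).toLinearPMap

theorem IsAdmissibleSpeed.ae_of_ae_weight {lam : ℝ → ℝ} (hlam : IsAdmissibleSpeed lam)
    {p : ℝ → Prop} (h : ∀ᵐ ζ ∂weightMeasure lam, p ζ) : ∀ᵐ ζ ∂unitVolume, p ζ := by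
  obtain ⟨ε, hε, hb⟩ := hlam.bound
  refine (withDensity_absolutelyContinuous' ?_ ?_).ae_le h
  · exact hlam.memLp.1.aemeasurable.ennreal_ofReal
  · filter_upwards [hb] with ζ hζ
    simpa using hε.trans_le hζ

theorem IsAdmissibleSpeed.ae_weight_of_ae {lam : ℝ → ℝ}
    {p : ℝ → Prop} (h : ∀ᵐ ζ ∂unitVolume, p ζ) : ∀ᵐ ζ ∂weightMeasure lam, p ζ :=
  (withDensity_absolutelyContinuous _ _).ae_le h

/-- For an admissible coefficient the graph is single-valued, so that `transportOperator` has
the intended graph. -/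
theorem mem_graph_transportOperator {n : ℕ} {lam : ℝ → ℝ} (hlam : IsAdmissibleSpeed lam)
    (W₀ W₁ : Matrix (Fin n) (Fin n) ℂ) (f g : StateSpace n lam) :
    (f, g) ∈ (transportOperator lam W₀ W₁).graph ↔
      ∃ u v : ℝ → EuclideanSpace ℂ (Fin n), IsH1 u v ∧
        (∀ᵐ ζ ∂weightMeasure lam, (lam ζ : ℂ) • f ζ = u ζ) ∧
        (∀ᵐ ζ ∂weightMeasure lam, g ζ = - v ζ) ∧
        W₀.mulVec (u 0).ofLp + W₁.mulVec (u 1).ofLp = 0 := by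
  rw [transportOperator, Submodule.toLinearPMap_graph_eq]
  · rfl
  rintro ⟨a, b⟩ ⟨u, v, h, hu, hv, -⟩ h0
  change a = 0 at h0
  subst h0
  change ∀ᵐ ζ ∂weightMeasure lam, b ζ = - v ζ at hv
  have hu0 : u =ᵐ[volume.restrict (Ioo (0 : ℝ) 1)] fun _ => 0 := by
    have := hlam.ae_of_ae_weight hu
    have h2 := hlam.ae_of_ae_weight
      (Lp.coeFn_zero (EuclideanSpace ℂ (Fin n)) 2 (weightMeasure lam))
    filter_upwards [this, h2] with ζ h1 h2
    rw [← h1, h2]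
    simp
  have hI := h.intervalIntegrable (ζ := 1) (by simp)
  have hcont : ContinuousOn u (Icc 0 1) := by
    have h1 : ContinuousOn (fun ζ => u 0 + ∫ s in (0 : ℝ)..ζ, v s) (Icc 0 1) := by
      have := intervalIntegral.continuousOn_primitive_interval' hI (left_mem_uIcc)
      rw [uIcc_of_le zero_le_one] at this
      exact continuousOn_const.add this
    exact h1.congr fun ζ hζ => h.eq_integral ζ hζ
  have hz : EqOn u (fun _ => 0) (Icc 0 1) := by
    refine Measure.eqOn_Icc_of_ae_eq (μ := volume) zero_ne_one ?_ hcont continuousOn_const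
    rw [← restrict_Ioo_eq_restrict_Icc]
    exact hu0
  have hvz : ∀ᵐ ζ ∂unitVolume, v ζ = 0 := by
    rw [ae_restrict_iff' measurableSet_Ioo]
    filter_upwards [hI.ae_hasDerivAt_integral] with ζ hζ hmem
    have hd := hζ (by rw [uIcc_of_le zero_le_one]; exact Ioo_subset_Icc_self hmem) 0 left_mem_uIcc
    refine hd.unique ((hasDerivAt_const ζ (0 : EuclideanSpace ℂ (Fin n))).congr_of_eventuallyEq ?_)
    filter_upwards [Ioo_mem_nhds hmem.1 hmem.2] with x hx
    have h1 := h.eq_integral x (Ioo_subset_Icc_self hx)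
    rw [hz (Ioo_subset_Icc_self hx), hz (left_mem_Icc.2 zero_le_one)] at h1
    simpa using h1.symm
  have hb : b = 0 := by
    refine Lp.ext ?_
    filter_upwards [hv, IsAdmissibleSpeed.ae_weight_of_ae hvz,
      Lp.coeFn_zero (EuclideanSpace ℂ (Fin n)) 2 (weightMeasure lam)] with ζ h1 h2 h3
    rw [h1, h2, h3]
    simp
  exact hb

end

/-! Write `τ` for the travel time, `a = τ(1)` and `W = L P(1)`. Solutions of the transport equation
move along characteristics and cross the interval in time `a`; the boundary condition converts what
leaves at `1` into what enters at `0`. Hence, as operators on `X`, with constant matrices acting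
pointwise, `K T(a) = -W` (`pointwiseMul_op_travelTime`).

This identity is proved weakly. Orbits in the domain are paired with `k(τ(ζ) - s)`, where `k` is
smooth and supported in `[0, a]`. The shift `s` moves with time so that the interior terms cancel
(`travelPairing_shiftRight_sub`), and the boundary condition cancels the rest
(`matrixCLM_travelPairing_op_eq`). Such pairings separate points
(`eq_zero_of_travelPairing_eq_zero`), and the domain is dense.

The generation hypothesis forces `K` to be invertible (`isUnit_left_boundary_matrix`): a row vector
annihilating `K` would also annihilate `W`, so `K + zW` would be singular for every `z`. Every real
`s` would then be an eigenvalue of the generator, and `exp(s a)` would be bounded by the norm of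
`T(a)` for all `s`.

Thus `T(a) = -K⁻¹ W` pointwise. If `W` is invertible, so is `T(a)`, and a semigroup with one
invertible operator at a positive time extends to a group (`extendsToGroup_of_isUnit`). If `W c = 0`
with `c ≠ 0`, the constant state `c` is killed by `T(a)`, which is impossible in a group. Finally
`P(1)` is invertible by a backward Gronwall argument (`IsFundamentalSolution.isUnit_apply_one`), so
`W` is invertible exactly when `L` is. -/

/-! ### Semigroups: continuity, generator, extension to a group -/

namespace C0Semigroup

variable {X : Type*} [NormedAddCommGroup X] [NormedSpace ℂ X]

theorem op_add_apply (T : C0Semigroup X) (s t : ℝ≥0) (x : X) :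
    T.op (s + t) x = T.op s (T.op t x) := by
  rw [T.op_add]; rfl

theorem op_comm_apply (T : C0Semigroup X) (s t : ℝ≥0) (x : X) :
    T.op s (T.op t x) = T.op t (T.op s x) := by
  rw [← op_add_apply, add_comm, op_add_apply]

/-- Otherwise the norms blow up along some sequence of times tending to `0`, on which every orbit
converges and is therefore bounded; this contradicts Banach–Steinhaus. -/
theorem exists_norm_le_near_zero [CompleteSpace X] (T : C0Semigroup X) :
    ∃ δ : ℝ≥0, 0 < δ ∧ ∃ C : ℝ, ∀ t ≤ δ, ‖T.op t‖ ≤ C := by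
  by_contra! h
  have h1 : ∀ k : ℕ, (0 : ℝ≥0) < 1 / ((k : ℝ≥0) + 1) := fun k => by positivity
  choose t ht hT using fun k : ℕ => h _ (h1 k) k
  have hlim : Tendsto t atTop (𝓝 0) :=
    tendsto_of_tendsto_of_tendsto_of_le_of_le tendsto_const_nhds
      tendsto_one_div_add_atTop_nhds_zero_nat (fun _ => zero_le) ht
  obtain ⟨C, hC⟩ := banach_steinhaus (g := fun k => T.op (t k)) fun x => by
    obtain ⟨C, hC⟩ := (Metric.isBounded_range_of_tendsto _
      ((T.tendsto_zero x).comp hlim)).exists_norm_le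
    exact ⟨C, fun k => hC _ ⟨k, rfl⟩⟩
  obtain ⟨k, hk⟩ := exists_nat_gt C
  exact absurd (hC k) (not_le.2 (hk.trans (hT k)))

theorem exists_norm_le [CompleteSpace X] (T : C0Semigroup X) (R : ℝ≥0) :
    ∃ C : ℝ, ∀ t ≤ R, ‖T.op t‖ ≤ C := by
  obtain ⟨δ, hδ, C, hC⟩ := T.exists_norm_le_near_zero
  have key : ∀ k : ℕ, ∃ C : ℝ, ∀ t ≤ k * δ, ‖T.op t‖ ≤ C := by
    intro k
    induction k with
    | zero => exact ⟨C, fun t ht => hC t (ht.trans (by simp))⟩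
    | succ k ih =>
      obtain ⟨D, hD⟩ := ih
      have hC0 : 0 ≤ C := (norm_nonneg _).trans (hC 0 zero_le)
      refine ⟨max D (C * D), fun t ht => ?_⟩
      rcases le_total t (k * δ) with h | h
      · exact (hD t h).trans (le_max_left _ _)
      · have h2 : t - k * δ ≤ δ := by
          rw [tsub_le_iff_left]
          refine ht.trans (le_of_eq ?_)
          push_cast
          ring
        have h3 : t = (t - k * δ) + k * δ := (tsub_add_cancel_of_le h).symm
        rw [h3, T.op_add]
        refine (ContinuousLinearMap.opNorm_comp_le _ _).trans (le_trans ?_ (le_max_right _ _))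
        gcongr
        · exact hC _ h2
        · exact hD _ le_rfl
  obtain ⟨k, hk⟩ := exists_nat_ge (R / δ)
  obtain ⟨D, hD⟩ := key k
  exact ⟨D, fun t ht => hD t (ht.trans ((div_le_iff₀ hδ).1 hk))⟩

theorem norm_op_sub_le (T : C0Semigroup X) {R : ℝ≥0} {C : ℝ} (hC : ∀ t ≤ R, ‖T.op t‖ ≤ C)
    {s t : ℝ≥0} (hst : s ≤ t) (hs : s ≤ R) (x : X) :
    ‖T.op t x - T.op s x‖ ≤ C * ‖T.op (t - s) x - x‖ := by
  have h : T.op t x - T.op s x = T.op s (T.op (t - s) x - x) := by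
    rw [map_sub, ← op_add_apply, add_tsub_cancel_of_le hst]
  rw [h]
  exact (T.op s).le_of_opNorm_le (hC s hs) _

theorem continuous_op_apply [CompleteSpace X] (T : C0Semigroup X) (x : X) :
    Continuous fun t => T.op t x := by
  rw [continuous_iff_continuousAt]
  intro t₀
  obtain ⟨C, hC⟩ := T.exists_norm_le (t₀ + 1)
  have hd : Tendsto (fun t : ℝ≥0 => (t - t₀) + (t₀ - t)) (𝓝 t₀) (𝓝 0) := by
    have : Continuous fun t : ℝ≥0 => (t - t₀) + (t₀ - t) := by fun_prop
    simpa using this.tendsto t₀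
  have hlim : Tendsto (fun t : ℝ≥0 => C * ‖T.op ((t - t₀) + (t₀ - t)) x - x‖) (𝓝 t₀) (𝓝 0) := by
    have := (((T.tendsto_zero x).comp hd).sub_const x).norm.const_mul C
    simpa using this
  rw [ContinuousAt, tendsto_iff_norm_sub_tendsto_zero]
  refine squeeze_zero' (Eventually.of_forall fun _ => norm_nonneg _) ?_ hlim
  have hn : ∀ᶠ t in 𝓝 t₀, t < t₀ + 1 := Iio_mem_nhds (lt_add_of_pos_right _ one_pos)
  filter_upwards [hn] with t ht
  rcases le_total t t₀ with h | h
  · rw [tsub_eq_zero_of_le h, zero_add, norm_sub_rev]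
    exact T.norm_op_sub_le hC h ht.le x
  · rw [tsub_eq_zero_of_le h, add_zero]
    exact T.norm_op_sub_le hC h (le_add_of_nonneg_right zero_le_one) x

theorem mem_graph_generator_op (T : C0Semigroup X) {x y : X} (h : (x, y) ∈ T.generator.graph)
    (t : ℝ≥0) : (T.op t x, T.op t y) ∈ T.generator.graph := by
  rw [mem_graph_generator] at h ⊢
  refine (((T.op t).continuous.tendsto y).comp h).congr fun s => ?_
  simp only [quotient, Function.comp_apply, map_smul, map_sub, T.op_comm_apply t s]

theorem tendsto_toNNReal_sub_nhdsGT (t : ℝ) :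
    Tendsto (fun s : ℝ => (s - t).toNNReal) (𝓝[>] t) (𝓝[>] 0) := by
  refine tendsto_nhdsWithin_iff.2 ⟨?_, ?_⟩
  · have : Continuous fun s : ℝ => (s - t).toNNReal := by fun_prop
    have := this.tendsto t
    simp only [sub_self, Real.toNNReal_zero] at this
    exact this.mono_left nhdsWithin_le_nhds
  · filter_upwards [self_mem_nhdsWithin] with s hs
    simpa using hs

/-- Only the right derivative follows directly from the definition of the generator. It suffices
here, since a continuous function with zero right derivative is constant. -/
theorem hasDerivWithinAt_op (T : C0Semigroup X) {x y : X} (h : (x, y) ∈ T.generator.graph)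
    {t : ℝ} (ht : 0 ≤ t) :
    HasDerivWithinAt (fun s : ℝ => T.op s.toNNReal x) (T.op t.toNNReal y) (Ici t) t := by
  rw [← hasDerivWithinAt_Ioi_iff_Ici, hasDerivWithinAt_iff_tendsto_slope' (by simp)]
  have h1 := (T.mem_graph_generator _ _).1 (T.mem_graph_generator_op h t.toNNReal)
  refine (h1.comp (tendsto_toNNReal_sub_nhdsGT t)).congr' ?_
  filter_upwards [self_mem_nhdsWithin] with s hs
  have hs' : t < s := hs
  have hst : (s - t).toNNReal + t.toNNReal = s.toNNReal := by
    rw [← Real.toNNReal_add (sub_nonneg.2 hs'.le) ht, sub_add_cancel]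
  simp only [Function.comp_apply, quotient, slope_def_module]
  rw [← op_add_apply, hst, Real.coe_toNNReal _ (sub_nonneg.2 hs'.le), ← Complex.ofReal_inv,
    Complex.coe_smul]

theorem continuous_op_toNNReal [CompleteSpace X] (T : C0Semigroup X) (x : X) :
    Continuous fun t : ℝ => T.op t.toNNReal x :=
  (T.continuous_op_apply x).comp continuous_real_toNNReal

/-- `T(k)` translates the window of integration from `[0, h]` to `[k, h + k]`. The overlap cancels,
so the difference quotient is the slope of the primitive at `h` minus its slope at `0`. -/
theorem integral_mem_domain [CompleteSpace X] (T : C0Semigroup X) (x : X) {h : ℝ} (hh : 0 ≤ h) :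
    (∫ s in (0 : ℝ)..h, T.op s.toNNReal x, T.op h.toNNReal x - x) ∈ T.generator.graph := by
  rw [mem_graph_generator]
  have hc := T.continuous_op_toNNReal x
  have hi : ∀ a b : ℝ, IntervalIntegrable (fun s : ℝ => T.op s.toNNReal x) volume a b :=
    fun a b => hc.intervalIntegrable a b
  have hd : ∀ t : ℝ, Tendsto (slope (fun b => ∫ s in (0 : ℝ)..b, T.op s.toNNReal x) t)
      (𝓝[>] t) (𝓝 (T.op t.toNNReal x)) := fun t => by
    rw [← hasDerivWithinAt_iff_tendsto_slope' (by simp)]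
    exact (hc.integral_hasStrictDerivAt 0 t).hasDerivAt.hasDerivWithinAt
  have hcoe : Tendsto (fun k : ℝ≥0 => (k : ℝ)) (𝓝[>] 0) (𝓝[>] 0) :=
    tendsto_nhdsWithin_iff.2 ⟨(NNReal.continuous_coe.tendsto' 0 0 rfl).mono_left
      nhdsWithin_le_nhds, by filter_upwards [self_mem_nhdsWithin] with k hk using hk⟩
  have hcoeh : Tendsto (fun k : ℝ≥0 => h + (k : ℝ)) (𝓝[>] 0) (𝓝[>] h) := by
    refine tendsto_nhdsWithin_iff.2 ⟨?_, ?_⟩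
    · have : Continuous fun k : ℝ≥0 => h + (k : ℝ) := by fun_prop
      exact (this.tendsto' 0 h (by simp)).mono_left nhdsWithin_le_nhds
    · filter_upwards [self_mem_nhdsWithin] with k hk
      simpa using hk
  have h1 := ((hd h).comp hcoeh).sub ((hd 0).comp hcoe)
  simp only [Real.toNNReal_zero, T.op_zero, ContinuousLinearMap.id_apply] at h1
  refine h1.congr fun k => ?_
  have hT : T.op k (∫ s in (0 : ℝ)..h, T.op s.toNNReal x) =
      ∫ s in (k : ℝ)..(h + k), T.op s.toNNReal x := by
    rw [← ContinuousLinearMap.intervalIntegral_comp_comm _ (hi 0 h)]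
    have := intervalIntegral.integral_comp_add_right (a := 0) (b := h)
      (fun s : ℝ => T.op s.toNNReal x) (k : ℝ)
    rw [zero_add] at this
    rw [← this]
    refine intervalIntegral.integral_congr fun s hs => ?_
    rw [uIcc_of_le hh] at hs
    rw [← op_add_apply, Real.toNNReal_add hs.1 k.coe_nonneg, Real.toNNReal_coe, add_comm]
  have hI : ∫ s in (k : ℝ)..(h + k), T.op s.toNNReal x =
      (∫ s in (0 : ℝ)..(h + k), T.op s.toNNReal x) - ∫ s in (0 : ℝ)..k, T.op s.toNNReal x :=
    (intervalIntegral.integral_interval_sub_left (hi _ _) (hi _ _)).symm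
  simp only [quotient, Function.comp_apply, slope_def_module, hT, hI,
    intervalIntegral.integral_same, sub_zero, add_sub_cancel_left]
  rw [← Complex.ofReal_inv, Complex.coe_smul, ← smul_sub]
  congr 1
  abel

theorem dense_domain_generator [CompleteSpace X] (T : C0Semigroup X) :
    Dense {x : X | ∃ y, (x, y) ∈ T.generator.graph} := by
  intro x
  have hd : Tendsto (slope (fun b => ∫ s in (0 : ℝ)..b, T.op s.toNNReal x) 0)
      (𝓝[>] 0) (𝓝 (T.op (0 : ℝ).toNNReal x)) := by
    rw [← hasDerivWithinAt_iff_tendsto_slope' (by simp)]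
    exact ((T.continuous_op_toNNReal x).integral_hasStrictDerivAt 0 0).hasDerivAt.hasDerivWithinAt
  simp only [Real.toNNReal_zero, T.op_zero, ContinuousLinearMap.id_apply] at hd
  refine mem_closure_of_tendsto hd ?_
  filter_upwards [self_mem_nhdsWithin] with h hh
  refine ⟨((h⁻¹ : ℝ) : ℂ) • (T.op h.toNNReal x - x), ?_⟩
  have := T.generator.graph.smul_mem ((h⁻¹ : ℝ) : ℂ) (T.integral_mem_domain x (le_of_lt hh))
  simp only [slope_def_module, sub_zero, intervalIntegral.integral_same]
  rw [← Complex.coe_smul]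
  exact this

/-- An eigenvector of the generator evolves exponentially. -/
theorem op_apply_eq_exp_smul [CompleteSpace X] (T : C0Semigroup X) {x : X} {s : ℝ}
    (h : (x, (s : ℂ) • x) ∈ T.generator.graph) (t : ℝ≥0) :
    T.op t x = (Real.exp (s * t) : ℂ) • x := by
  -- The function `exp(-s r) T(r) x` has zero right derivative.
  have hconst := constant_of_has_deriv_right_zero (a := 0) (b := (t : ℝ))
    (f := fun r : ℝ => Real.exp (-(s * r)) • T.op r.toNNReal x)
    (((by fun_prop : Continuous fun r : ℝ => Real.exp (-(s * r))).smul
      (T.continuous_op_toNNReal x)).continuousOn) ?_ t ⟨t.2, le_rfl⟩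
  · simp only [Real.toNNReal_coe, mul_zero, neg_zero, Real.exp_zero, Real.toNNReal_zero,
      T.op_zero, ContinuousLinearMap.id_apply, one_smul] at hconst
    have : Real.exp (s * t) • (Real.exp (-(s * t)) • T.op t x) = Real.exp (s * t) • x := by
      rw [hconst]
    rw [smul_smul, ← Real.exp_add, add_neg_cancel, Real.exp_zero, one_smul] at this
    rw [this, Complex.coe_smul]
  · intro r hr
    have h1 := T.hasDerivWithinAt_op h hr.1
    have h2 : HasDerivAt (fun r : ℝ => Real.exp (-(s * r))) (Real.exp (-(s * r)) * (-s)) r := by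
      have := ((hasDerivAt_id r).const_mul s).neg.exp
      simpa using this
    refine (h2.hasDerivWithinAt.smul h1).congr_deriv ?_
    rw [map_smul, Complex.coe_smul, smul_smul, ← add_smul]
    simp

/-- For `k a ≥ t`, the operator `T(t)` is one of two commuting factors of the invertible `T(k a) =
T(a)^k`. -/
theorem isUnit_op_of_isUnit (T : C0Semigroup X) {a : ℝ≥0} (ha : 0 < a) (h : IsUnit (T.op a))
    (t : ℝ≥0) : IsUnit (T.op t) := by
  have hmul : ∀ s t, T.op (s + t) = T.op s * T.op t := T.op_add
  have hk : ∀ k : ℕ, T.op (k * a) = T.op a ^ k := by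
    intro k
    induction k with
    | zero => simpa using! T.op_zero
    | succ k ih => rw [pow_succ, ← ih, ← hmul]; congr 1; push_cast; ring
  obtain ⟨k, hk'⟩ := exists_nat_ge (t / a)
  have hle : t ≤ k * a := (div_le_iff₀ ha).1 hk'
  have hc : Commute (T.op t) (T.op (k * a - t)) := by
    rw [Commute, SemiconjBy, ← hmul, ← hmul, add_comm]
  have := hc.isUnit_mul_iff.1 (by rw [← hmul, add_tsub_cancel_of_le hle, hk]; exact h.pow k)
  exact this.1

theorem extendsToGroup_of_isUnit [CompleteSpace X] (T : C0Semigroup X) {a : ℝ≥0} (ha : 0 < a)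
    (h : IsUnit (T.op a)) : T.ExtendsToGroup := by
  have hu := T.isUnit_op_of_isUnit ha h
  have hmul : ∀ s t, T.op (s + t) = T.op s * T.op t := T.op_add
  have hcomm : ∀ s t, T.op s * T.op t = T.op t * T.op s := fun s t => by
    rw [← hmul, ← hmul, add_comm]
  have hinv : ∀ s, T.op s * Ring.inverse (T.op s) = 1 := fun s => Ring.mul_inverse_cancel _ (hu s)
  have hinv' : ∀ s, Ring.inverse (T.op s) * T.op s = 1 := fun s => Ring.inverse_mul_cancel _ (hu s)
  have hcommi : ∀ s t, T.op s * Ring.inverse (T.op t) = Ring.inverse (T.op t) * T.op s :=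
    fun s t => by
      calc T.op s * Ring.inverse (T.op t)
          = Ring.inverse (T.op t) * (T.op t * T.op s) * Ring.inverse (T.op t) := by
            rw [← mul_assoc, hinv', one_mul]
        _ = Ring.inverse (T.op t) * T.op s * (T.op t * Ring.inverse (T.op t)) := by
            rw [hcomm t s]; simp only [mul_assoc]
        _ = _ := by rw [hinv, mul_one]
  -- Equality of fractions: `T(p) T(q)⁻¹` depends only on the difference `p - q`.
  have key : ∀ p q r s : ℝ≥0, p + s = r + q →
      T.op p * Ring.inverse (T.op q) = T.op r * Ring.inverse (T.op s) := by
    intro p q r s hpq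
    have h1 : T.op p * T.op s = T.op r * T.op q := by rw [← hmul, ← hmul, hpq]
    calc T.op p * Ring.inverse (T.op q)
        = T.op p * (T.op s * Ring.inverse (T.op s)) * Ring.inverse (T.op q) := by
          rw [hinv, mul_one]
      _ = T.op r * T.op q * Ring.inverse (T.op s) * Ring.inverse (T.op q) := by
          rw [← h1]; simp only [mul_assoc]
      _ = T.op r * (T.op q * Ring.inverse (T.op s)) * Ring.inverse (T.op q) := by
          simp only [mul_assoc]
      _ = T.op r * Ring.inverse (T.op s) * (T.op q * Ring.inverse (T.op q)) := by
          rw [hcommi q s]; simp only [mul_assoc]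
      _ = _ := by rw [hinv, mul_one]
  have key0 : ∀ t : ℝ≥0, T.op t = T.op t * Ring.inverse (T.op 0) := fun t => by
    have := hinv 0
    have h0 : T.op 0 = 1 := T.op_zero
    rw [h0, Ring.inverse_one, mul_one]
  -- `G(t) = T(t⁺) T(t⁻)⁻¹` with positive and negative parts, which avoids a case split on the sign
  -- of `t`.
  refine ⟨⟨fun t => T.op t.toNNReal * Ring.inverse (T.op (-t).toNNReal), ?_, ?_, ?_⟩, ?_⟩
  · simp only [neg_zero, Real.toNNReal_zero]
    exact hinv 0
  · intro s t
    change _ = (T.op s.toNNReal * Ring.inverse (T.op (-s).toNNReal)) *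
      (T.op t.toNNReal * Ring.inverse (T.op (-t).toNNReal))
    have h1 : (T.op s.toNNReal * Ring.inverse (T.op (-s).toNNReal)) *
        (T.op t.toNNReal * Ring.inverse (T.op (-t).toNNReal)) =
        T.op (s.toNNReal + t.toNNReal) * Ring.inverse (T.op ((-s).toNNReal + (-t).toNNReal)) := by
      rw [add_comm (-s).toNNReal, hmul, hmul, Ring.mul_inverse_rev' (hcomm _ _)]
      calc _ = T.op s.toNNReal * (Ring.inverse (T.op (-s).toNNReal) *
            T.op t.toNNReal) * Ring.inverse (T.op (-t).toNNReal) := by simp only [mul_assoc]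
        _ = _ := by rw [← hcommi]; simp only [mul_assoc]
    rw [h1]
    refine key _ _ _ _ ?_
    have e : ∀ r : ℝ, (r.toNNReal : ℝ) - ((-r).toNNReal : ℝ) = r := fun r => by
      simp
    apply NNReal.coe_injective
    push_cast
    have := e s
    have := e t
    have := e (s + t)
    linarith
  · intro x
    -- For `t > -a`, `G(t) = T(a)⁻¹ T(a + t)`, so two-sided continuity at `0` reduces to continuity
    -- of the semigroup at the positive time `a`.
    have hc : Continuous fun t : ℝ => Ring.inverse (T.op a) (T.op (a + t).toNNReal x) :=
      (Ring.inverse (T.op a)).continuous.comp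
        ((T.continuous_op_toNNReal x).comp (by fun_prop))
    have hx : Ring.inverse (T.op a) (T.op ((a : ℝ) + 0).toNNReal x) = x := by
      rw [add_zero, Real.toNNReal_coe]
      exact congrArg (fun S : X →L[ℂ] X => S x) (hinv' a)
    refine (hc.tendsto' 0 x hx).congr' ?_
    have hn : ∀ᶠ t : ℝ in 𝓝 0, -(a : ℝ) < t := Ioi_mem_nhds (by simpa using ha)
    filter_upwards [hn] with t ht
    have h1 : T.op t.toNNReal * Ring.inverse (T.op (-t).toNNReal) =
        T.op ((a : ℝ) + t).toNNReal * Ring.inverse (T.op a) := by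
      refine key _ _ _ _ ?_
      apply NNReal.coe_injective
      have e : (t.toNNReal : ℝ) - ((-t).toNNReal : ℝ) = t := by
        simp
      push_cast
      rw [Real.coe_toNNReal _ (by linarith : (0 : ℝ) ≤ a + t)]
      linarith
    rw [h1, hcommi]
    rfl
  · intro t
    simp only [Real.toNNReal_coe]
    have : (-(t : ℝ)).toNNReal = 0 := by simp
    rw [this]
    exact (key0 t).symm

theorem ExtendsToGroup.injective {T : C0Semigroup X} (h : T.ExtendsToGroup) (t : ℝ≥0) :
    Function.Injective (T.op t) := by
  obtain ⟨G, hG⟩ := h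
  intro x y hxy
  have e : ∀ z, G.op (-(t : ℝ)) (T.op t z) = z := fun z => by
    rw [← hG, ← ContinuousLinearMap.comp_apply, ← G.op_add, neg_add_cancel, G.op_zero]
    rfl
  rw [← e x, hxy, e y]

end C0Semigroup

/-! ### The fundamental theorem of calculus for absolutely continuous vector functions -/

section AbsolutelyContinuous

variable {F : Type*} [NormedAddCommGroup F] [NormedSpace ℝ F] {a b : ℝ}

/-- Increments of the primitive are dominated by those of the scalar primitive of `‖v‖`. -/
theorem IntervalIntegrable.absolutelyContinuousOnInterval_primitive {v : ℝ → F}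
    (h : IntervalIntegrable v volume a b) :
    AbsolutelyContinuousOnInterval (fun x => ∫ s in a..x, v s) a b := by
  have hn := h.norm.absolutelyContinuousOnInterval_intervalIntegral (c := a) left_mem_uIcc
  rw [absolutelyContinuousOnInterval_iff] at hn ⊢
  intro ε hε
  obtain ⟨δ, hδ, H⟩ := hn ε hε
  refine ⟨δ, hδ, fun I hI hlt => lt_of_le_of_lt (Finset.sum_le_sum fun i hi => ?_) (H I hI hlt)⟩
  have hmem := hI.1 i hi
  have hs : ∀ x ∈ uIcc a b, IntervalIntegrable v volume a x := fun x hx =>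
    h.mono_set (uIcc_subset_uIcc_left hx)
  rw [dist_comm, dist_comm (∫ s in a.._, ‖v s‖), dist_eq_norm, dist_eq_norm,
    intervalIntegral.integral_interval_sub_left (hs _ hmem.2) (hs _ hmem.1),
    intervalIntegral.integral_interval_sub_left (hs _ hmem.2).norm (hs _ hmem.1).norm]
  exact intervalIntegral.norm_integral_le_abs_integral_norm

/-- Subtracting the primitive of `w` leaves an absolutely continuous function with derivative zero
almost everywhere, hence a constant. -/
theorem AbsolutelyContinuousOnInterval.integral_eq_sub_of_ae_hasDerivAt [CompleteSpace F]
    {f w : ℝ → F} (hf : AbsolutelyContinuousOnInterval f a b)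
    (hw : IntervalIntegrable w volume a b)
    (hd : ∀ᵐ x, x ∈ uIcc a b → HasDerivAt f (w x) x) :
    ∫ x in a..b, w x = f b - f a := by
  obtain ⟨C, hC⟩ := (hf.sub hw.absolutelyContinuousOnInterval_primitive).const_of_ae_hasDerivAt_zero
    (by
      filter_upwards [hd, hw.ae_hasDerivAt_integral] with x h1 h2 hx
      simpa using (h1 hx).sub (h2 hx a left_mem_uIcc))
  have h1 := hC a left_mem_uIcc
  have h2 := hC b right_mem_uIcc
  simp only [Pi.sub_apply, intervalIntegral.integral_same, sub_zero] at h1 h2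
  rw [h1, ← h2]
  abel

end AbsolutelyContinuous

/-! ### Travel time -/

/-- The travel time from `0` to `ζ`. -/
noncomputable def travelTime (lam : ℝ → ℝ) (ζ : ℝ) : ℝ := ∫ s in (0 : ℝ)..ζ, (lam s)⁻¹

@[simp] theorem travelTime_zero (lam : ℝ → ℝ) : travelTime lam 0 = 0 := by simp [travelTime]

theorem ae_unitVolume_iff {p : ℝ → Prop} :
    (∀ᵐ ζ ∂unitVolume, p ζ) ↔ ∀ᵐ ζ, ζ ∈ Icc (0 : ℝ) 1 → p ζ := by
  rw [unitVolume, restrict_Ioo_eq_restrict_Icc, ae_restrict_iff' measurableSet_Icc]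

theorem integral_unitVolume {F : Type*} [NormedAddCommGroup F] [NormedSpace ℝ F] (f : ℝ → F) :
    ∫ ζ, f ζ ∂unitVolume = ∫ ζ in (0 : ℝ)..1, f ζ := by
  rw [intervalIntegral.integral_of_le zero_le_one, unitVolume, restrict_Ioo_eq_restrict_Ioc]

theorem intervalIntegrable_iff_unitVolume {F : Type*} [NormedAddCommGroup F] (f : ℝ → F) :
    IntervalIntegrable f volume 0 1 ↔ Integrable f unitVolume := by
  rw [intervalIntegrable_iff_integrableOn_Ioo_of_le zero_le_one]
  rfl

instance isProbabilityMeasure_unitVolume : IsProbabilityMeasure unitVolume :=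
  ⟨by simp [unitVolume]⟩

namespace IsAdmissibleSpeed

variable {lam : ℝ → ℝ}

theorem ae_pos (hlam : IsAdmissibleSpeed lam) : ∀ᵐ ζ ∂unitVolume, 0 < lam ζ := by
  obtain ⟨ε, hε, hb⟩ := hlam.bound
  filter_upwards [hb] with ζ hζ using hε.trans_le hζ

theorem exists_inv_le (hlam : IsAdmissibleSpeed lam) :
    ∃ C : ℝ, 0 < C ∧ ∀ᵐ ζ ∂unitVolume, ‖(lam ζ)⁻¹‖ ≤ C := by
  obtain ⟨ε, hε, hb⟩ := hlam.bound
  refine ⟨ε⁻¹, by positivity, ?_⟩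
  filter_upwards [hb] with ζ hζ
  rw [norm_inv, Real.norm_of_nonneg (hε.le.trans hζ)]
  gcongr

theorem exists_le_inv (hlam : IsAdmissibleSpeed lam) :
    ∃ c : ℝ, 0 < c ∧ ∀ᵐ ζ ∂unitVolume, c ≤ (lam ζ)⁻¹ := by
  have hfin : eLpNormEssSup lam unitVolume < ∞ := by simpa using hlam.memLp.2
  refine ⟨((eLpNormEssSup lam unitVolume).toReal + 1)⁻¹, by positivity, ?_⟩
  filter_upwards [hlam.ae_pos, ae_le_eLpNormEssSup (f := lam) (μ := unitVolume)] with ζ h0 h1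
  have h2 : lam ζ ≤ (eLpNormEssSup lam unitVolume).toReal := by
    have := ENNReal.toReal_mono hfin.ne h1
    rw [toReal_enorm, Real.norm_of_nonneg h0.le] at this
    exact this
  gcongr
  linarith

theorem aestronglyMeasurable_inv (hlam : IsAdmissibleSpeed lam) :
    AEStronglyMeasurable (fun ζ => (lam ζ)⁻¹) unitVolume :=
  hlam.memLp.1.aemeasurable.inv.aestronglyMeasurable

theorem integrable_inv (hlam : IsAdmissibleSpeed lam) :
    Integrable (fun ζ => (lam ζ)⁻¹) unitVolume := by
  obtain ⟨C, -, hC⟩ := hlam.exists_inv_le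
  exact Integrable.of_bound hlam.aestronglyMeasurable_inv C hC

theorem intervalIntegrable_inv (hlam : IsAdmissibleSpeed lam) {a b : ℝ} (ha : a ∈ Icc (0 : ℝ) 1)
    (hb : b ∈ Icc (0 : ℝ) 1) : IntervalIntegrable (fun ζ => (lam ζ)⁻¹) volume a b :=
  ((intervalIntegrable_iff_unitVolume _).2 hlam.integrable_inv).mono_set
    (uIcc_subset_uIcc (by rwa [uIcc_of_le zero_le_one]) (by rwa [uIcc_of_le zero_le_one]))

theorem travelTime_sub (hlam : IsAdmissibleSpeed lam) {a b : ℝ} (ha : a ∈ Icc (0 : ℝ) 1)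
    (hb : b ∈ Icc (0 : ℝ) 1) :
    travelTime lam b - travelTime lam a = ∫ s in a..b, (lam s)⁻¹ :=
  intervalIntegral.integral_interval_sub_left
    (hlam.intervalIntegrable_inv (left_mem_Icc.2 zero_le_one) hb)
    (hlam.intervalIntegrable_inv (left_mem_Icc.2 zero_le_one) ha)

theorem strictMonoOn_travelTime (hlam : IsAdmissibleSpeed lam) :
    StrictMonoOn (travelTime lam) (Icc 0 1) := by
  intro a ha b hb hab
  obtain ⟨c, hc, hle⟩ := hlam.exists_le_inv
  rw [← sub_pos, hlam.travelTime_sub ha hb]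
  have h1 : ∫ _ in a..b, c ≤ ∫ s in a..b, (lam s)⁻¹ := by
    refine intervalIntegral.integral_mono_ae_restrict hab.le intervalIntegrable_const
      (hlam.intervalIntegrable_inv ha hb) ?_
    refine ae_restrict_of_ae_restrict_of_subset (Icc_subset_Icc ha.1 hb.2) ?_
    rw [← restrict_Ioo_eq_restrict_Icc]
    exact hle
  rw [intervalIntegral.integral_const, smul_eq_mul] at h1
  exact (mul_pos (sub_pos.2 hab) hc).trans_le h1

theorem exists_lipschitzOnWith_travelTime (hlam : IsAdmissibleSpeed lam) :
    ∃ C : ℝ≥0, LipschitzOnWith C (travelTime lam) (Icc 0 1) := by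
  obtain ⟨C, hC, hle⟩ := hlam.exists_inv_le
  refine ⟨C.toNNReal, LipschitzOnWith.of_dist_le_mul fun a ha b hb => ?_⟩
  rw [dist_eq_norm, hlam.travelTime_sub hb ha, Real.dist_eq, Real.coe_toNNReal _ hC.le]
  refine intervalIntegral.norm_integral_le_of_norm_le_const_ae ?_
  filter_upwards [ae_unitVolume_iff.1 hle] with x hx hmem
  have h1 : uIcc b a ⊆ Icc 0 1 := by
    rw [← uIcc_of_le (zero_le_one' ℝ)]
    exact uIcc_subset_uIcc (by rwa [uIcc_of_le zero_le_one]) (by rwa [uIcc_of_le zero_le_one])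
  exact hx (h1 (uIoc_subset_uIcc hmem))

theorem travelTime_mem_Icc (hlam : IsAdmissibleSpeed lam) {ζ : ℝ} (hζ : ζ ∈ Icc (0 : ℝ) 1) :
    travelTime lam ζ ∈ Icc 0 (travelTime lam 1) := by
  have hm := hlam.strictMonoOn_travelTime.monotoneOn
  have h1 := hm (left_mem_Icc.2 zero_le_one) hζ hζ.1
  rw [travelTime_zero] at h1
  exact ⟨h1, hm hζ (right_mem_Icc.2 zero_le_one) hζ.2⟩

theorem travelTime_one_pos (hlam : IsAdmissibleSpeed lam) : 0 < travelTime lam 1 := by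
  have := hlam.strictMonoOn_travelTime (left_mem_Icc.2 zero_le_one) (right_mem_Icc.2 zero_le_one)
    zero_lt_one
  rwa [travelTime_zero] at this

theorem continuousOn_travelTime (hlam : IsAdmissibleSpeed lam) :
    ContinuousOn (travelTime lam) (Icc 0 1) := by
  obtain ⟨C, hC⟩ := hlam.exists_lipschitzOnWith_travelTime
  exact hC.continuousOn

theorem ae_hasDerivAt_travelTime (hlam : IsAdmissibleSpeed lam) :
    ∀ᵐ ζ ∂unitVolume, HasDerivAt (travelTime lam) (lam ζ)⁻¹ ζ := by
  rw [ae_unitVolume_iff, ← uIcc_of_le (zero_le_one' ℝ)]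
  filter_upwards [((intervalIntegrable_iff_unitVolume _).2
    hlam.integrable_inv).ae_hasDerivAt_integral] with ζ h hζ
  exact h hζ 0 left_mem_uIcc

theorem aestronglyMeasurable_comp_travelTime (hlam : IsAdmissibleSpeed lam)
    {F : Type*} [NormedAddCommGroup F] {k : ℝ → F} (hk : Continuous k) :
    AEStronglyMeasurable (fun ζ => k (travelTime lam ζ)) unitVolume := by
  rw [unitVolume, restrict_Ioo_eq_restrict_Icc]
  exact (hk.comp_continuousOn hlam.continuousOn_travelTime).aestronglyMeasurable_of_isCompact
    isCompact_Icc measurableSet_Icc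

theorem unitVolume_le (hlam : IsAdmissibleSpeed lam) :
    ∃ c : ℝ≥0∞, c ≠ ∞ ∧ unitVolume ≤ c • weightMeasure lam := by
  obtain ⟨ε, hε, hb⟩ := hlam.bound
  refine ⟨ENNReal.ofReal ε⁻¹, ENNReal.ofReal_ne_top, ?_⟩
  rw [weightMeasure, ← withDensity_smul' _ _ ENNReal.ofReal_ne_top]
  conv_lhs => rw [← withDensity_one (μ := unitVolume)]
  refine withDensity_mono ?_
  filter_upwards [hb] with ζ hζ
  simp only [Pi.one_apply, Pi.smul_apply, smul_eq_mul]
  rw [← ENNReal.ofReal_mul (by positivity), ENNReal.one_le_ofReal, inv_mul_eq_div, one_le_div hε]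
  exact hζ

variable {n : ℕ}

theorem memLp_unitVolume (hlam : IsAdmissibleSpeed lam) (g : StateSpace n lam) :
    MemLp g 2 unitVolume := by
  obtain ⟨c, hc, hle⟩ := hlam.unitVolume_le
  exact ((Lp.memLp g).smul_measure hc).mono_measure hle

theorem integrable_unitVolume (hlam : IsAdmissibleSpeed lam) (g : StateSpace n lam) :
    Integrable g unitVolume :=
  (hlam.memLp_unitVolume g).integrable one_le_two

/-- Lebesgue measure on `(0,1)` is a probability measure, so the `L¹` norm is at most the `L²` norm,
and it is dominated by a multiple of the weighted measure. This is what bounds the travel pairing.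
-/
theorem exists_integral_norm_le (hlam : IsAdmissibleSpeed lam) (n : ℕ) :
    ∃ C : ℝ, ∀ g : StateSpace n lam, ∫ ζ, ‖g ζ‖ ∂unitVolume ≤ C * ‖g‖ := by
  obtain ⟨c, hc, hle⟩ := hlam.unitVolume_le
  refine ⟨(c ^ (1 / 2 : ℝ≥0∞).toReal).toReal, fun g => ?_⟩
  have hm := (hlam.integrable_unitVolume g).1
  rw [integral_norm_eq_lintegral_enorm hm, ← eLpNorm_one_eq_lintegral_enorm, Lp.norm_def,
    ← ENNReal.toReal_mul]
  refine ENNReal.toReal_mono (ENNReal.mul_ne_top (ENNReal.rpow_ne_top_of_nonneg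
    ENNReal.toReal_nonneg hc) (Lp.eLpNorm_ne_top g)) ?_
  calc eLpNorm g 1 unitVolume ≤ eLpNorm g 2 unitVolume :=
        eLpNorm_le_eLpNorm_of_exponent_le one_le_two hm
    _ ≤ eLpNorm g 2 (c • weightMeasure lam) := eLpNorm_mono_measure _ hle
    _ = _ := by rw [eLpNorm_smul_measure_of_ne_top (by norm_num), smul_eq_mul]

end IsAdmissibleSpeed

theorem IsH1.intervalIntegrable_one {n : ℕ} {u v : ℝ → EuclideanSpace ℂ (Fin n)} (h : IsH1 u v) :
    IntervalIntegrable v volume 0 1 := h.intervalIntegrable (right_mem_Icc.2 zero_le_one)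

open scoped BoundedContinuousFunction

/-! ### Pairing states with functions of the travel time -/

section Pairing

variable {lam : ℝ → ℝ} {n : ℕ}

theorem IsAdmissibleSpeed.integrable_smul (hlam : IsAdmissibleSpeed lam) (k : ℝ →ᵇ ℂ)
    {g : ℝ → EuclideanSpace ℂ (Fin n)} (hg : Integrable g unitVolume) :
    Integrable (fun ζ => k (travelTime lam ζ) • g ζ) unitVolume :=
  hg.bdd_smul ‖k‖ (hlam.aestronglyMeasurable_comp_travelTime k.continuous)
    (ae_of_all _ fun _ => k.norm_coe_le_norm _)

/-- The pairing `(k, g) ↦ ∫₀¹ k(τ(ζ)) g(ζ) dζ`, where `τ` is the travel time. -/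
noncomputable def travelPairing (hlam : IsAdmissibleSpeed lam) :
    (ℝ →ᵇ ℂ) →L[ℂ] StateSpace n lam →L[ℂ] EuclideanSpace ℂ (Fin n) :=
  LinearMap.mkContinuousOfExistsBound₂
    (LinearMap.mk₂ ℂ (fun (k : ℝ →ᵇ ℂ) (g : StateSpace n lam) =>
        ∫ ζ, k (travelTime lam ζ) • g ζ ∂unitVolume)
      (fun k l g => by
        simp only [BoundedContinuousFunction.add_apply, add_smul]
        exact integral_add (hlam.integrable_smul k (hlam.integrable_unitVolume g))
          (hlam.integrable_smul l (hlam.integrable_unitVolume g)))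
      (fun c k g => by
        simp only [BoundedContinuousFunction.smul_apply, smul_assoc]
        exact integral_smul c _)
      (fun k f g => by
        rw [← integral_add (hlam.integrable_smul k (hlam.integrable_unitVolume f))
          (hlam.integrable_smul k (hlam.integrable_unitVolume g))]
        refine integral_congr_ae ?_
        filter_upwards [hlam.ae_of_ae_weight (Lp.coeFn_add f g)] with ζ hζ
        rw [hζ, Pi.add_apply, smul_add])
      (fun c k g => by
        rw [← integral_smul]
        refine integral_congr_ae ?_
        filter_upwards [hlam.ae_of_ae_weight (Lp.coeFn_smul c g)] with ζ hζ
        rw [hζ, Pi.smul_apply, smul_comm]))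
    (by
      obtain ⟨C, hC⟩ := hlam.exists_integral_norm_le n
      refine ⟨C, fun k g => ?_⟩
      rw [LinearMap.mk₂_apply]
      calc ‖∫ ζ, k (travelTime lam ζ) • g ζ ∂unitVolume‖
          ≤ ∫ ζ, ‖k‖ * ‖g ζ‖ ∂unitVolume := by
            refine norm_integral_le_of_norm_le ((hlam.integrable_unitVolume g).norm.const_mul _)
              (ae_of_all _ fun ζ => ?_)
            rw [norm_smul]
            gcongr
            exact k.norm_coe_le_norm _
        _ = ‖k‖ * ∫ ζ, ‖g ζ‖ ∂unitVolume := integral_const_mul _ _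
        _ ≤ ‖k‖ * (C * ‖g‖) := by gcongr; exact hC g
        _ = _ := by ring)

theorem travelPairing_apply (hlam : IsAdmissibleSpeed lam) (k : ℝ →ᵇ ℂ) (g : StateSpace n lam) :
    travelPairing hlam k g = ∫ ζ, k (travelTime lam ζ) • g ζ ∂unitVolume := rfl

/-- Translation of a bounded continuous function. -/
noncomputable def shiftRight (k : ℝ →ᵇ ℂ) (t : ℝ) : ℝ →ᵇ ℂ :=
  k.compContinuous ⟨fun x => x - t, by fun_prop⟩

theorem shiftRight_apply (k : ℝ →ᵇ ℂ) (t x : ℝ) : shiftRight k t x = k (x - t) := rfl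

/-- The mean value inequality is applied twice, first to `k'` and then to `k` minus its linear part;
the sharp factor `1/2` is not needed. -/
theorem norm_sub_sub_smul_le {k k' k'' : ℝ → ℂ} {C : ℝ} (h : ∀ x, HasDerivAt k (k' x) x)
    (h' : ∀ x, HasDerivAt k' (k'' x) x) (hC : ∀ x, ‖k'' x‖ ≤ C) (x y : ℝ) :
    ‖k y - k x - ((y - x : ℝ) : ℂ) * k' x‖ ≤ C * (y - x) ^ 2 := by
  have h1 : ∀ z, ‖k' z - k' x‖ ≤ C * ‖z - x‖ := fun z =>
    convex_univ.norm_image_sub_le_of_norm_hasDerivWithin_le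
      (fun w _ => (h' w).hasDerivWithinAt) (fun w _ => hC w) (mem_univ _) (mem_univ _)
  have hC0 : 0 ≤ C := (norm_nonneg _).trans (hC 0)
  have h2 : ∀ z ∈ uIcc x y, HasDerivWithinAt (fun z : ℝ => k z - ((z - x : ℝ) : ℂ) * k' x)
      (k' z - k' x) (uIcc x y) z := fun z _ => by
    have e : HasDerivAt (fun z : ℝ => ((z - x : ℝ) : ℂ) * k' x) (k' x) z := by
      simpa using (((hasDerivAt_id z).sub_const x).ofReal_comp).mul_const (k' x)
    exact ((h z).sub e).hasDerivWithinAt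
  have h3 := (convex_uIcc x y).norm_image_sub_le_of_norm_hasDerivWithin_le h2
    (C := C * ‖y - x‖) (fun z hz => (h1 z).trans (by
      gcongr
      exact abs_sub_left_of_mem_uIcc hz)) left_mem_uIcc right_mem_uIcc
  have e1 : k y - ((y - x : ℝ) : ℂ) * k' x - (k x - ((x - x : ℝ) : ℂ) * k' x) =
      k y - k x - ((y - x : ℝ) : ℂ) * k' x := by simp; ring
  have e2 : C * ‖y - x‖ * ‖y - x‖ = C * (y - x) ^ 2 := by
    rw [mul_assoc, Real.norm_eq_abs, abs_mul_abs_self, sq]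
  rwa [e1, e2] at h3

/-- Uniformity in `x` makes translation differentiable in the supremum norm. -/
theorem norm_shiftRight_sub_le {k k' k'' : ℝ →ᵇ ℂ} (h : ∀ x, HasDerivAt k (k' x) x)
    (h' : ∀ x, HasDerivAt k' (k'' x) x) (r t : ℝ) :
    ‖shiftRight k r - shiftRight k t + ((r - t : ℝ) : ℂ) • shiftRight k' t‖ ≤
      ‖k''‖ * (r - t) ^ 2 := by
  rw [BoundedContinuousFunction.norm_le (by positivity)]
  intro x
  have h1 := norm_sub_sub_smul_le h h' k''.norm_coe_le_norm (x - t) (x - r)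
  have e : (x - r - (x - t)) = -(r - t) := by ring
  rw [e, neg_sq, Complex.ofReal_neg, neg_mul, sub_neg_eq_add] at h1
  exact h1

/-- Integration by parts: since `τ' = 1/lam`, `u = lam f` and `v = -g`, the derivative of `k(τ - s)
u` is `k'(τ - s) f - k(τ - s) g`. Only the values at the two endpoints survive. -/
theorem travelPairing_shiftRight_sub (hlam : IsAdmissibleSpeed lam) {k k' : ℝ →ᵇ ℂ}
    (h : ∀ x, HasDerivAt k (k' x) x) (s : ℝ) {f g : StateSpace n lam}
    {u v : ℝ → EuclideanSpace ℂ (Fin n)} (huv : IsH1 u v)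
    (hu : ∀ᵐ ζ ∂weightMeasure lam, (lam ζ : ℂ) • f ζ = u ζ)
    (hv : ∀ᵐ ζ ∂weightMeasure lam, g ζ = - v ζ) :
    travelPairing hlam (shiftRight k s) g - travelPairing hlam (shiftRight k' s) f =
      k (-s) • u 0 - k (travelTime lam 1 - s) • u 1 := by
  have hVI := huv.intervalIntegrable_one
  -- `u` is prescribed only on `[0,1]`; the formula `U` is defined everywhere and has two-sided
  -- derivatives almost everywhere there.
  set U : ℝ → EuclideanSpace ℂ (Fin n) := fun ζ => u 0 + ∫ r in (0 : ℝ)..ζ, v r with hU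
  have hUu : ∀ ζ ∈ Icc (0 : ℝ) 1, u ζ = U ζ := huv.eq_integral
  have hUac : AbsolutelyContinuousOnInterval U 0 1 :=
    (LipschitzOnWith.absolutelyContinuousOnInterval
      (LipschitzWith.const (u 0)).lipschitzOnWith).add hVI.absolutelyContinuousOnInterval_primitive
  have hkL : LipschitzWith ‖k'‖₊ k :=
    lipschitzWith_of_nnnorm_deriv_le (fun x => (h x).differentiableAt) fun x => by
      rw [(h x).deriv]
      exact k'.norm_coe_le_norm x
  obtain ⟨C, hC⟩ := hlam.exists_lipschitzOnWith_travelTime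
  have hkac : AbsolutelyContinuousOnInterval (fun ζ => k (travelTime lam ζ - s)) 0 1 := by
    refine LipschitzOnWith.absolutelyContinuousOnInterval (K := ‖k'‖₊ * C) ?_
    rw [uIcc_of_le zero_le_one]
    have h1 : LipschitzWith ‖k'‖₊ (fun x => k (x - s)) := by
      have h0 : LipschitzWith 1 (fun x : ℝ => x - s) := LipschitzWith.of_dist_le_mul (by simp)
      simpa using! hkL.comp h0
    exact h1.comp_lipschitzOnWith hC
  have hf1 : ∀ᵐ ζ ∂unitVolume, f ζ = ((lam ζ)⁻¹ : ℝ) • u ζ := by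
    filter_upwards [hlam.ae_of_ae_weight hu, hlam.ae_pos] with ζ h1 h2
    rw [← h1, Complex.coe_smul, smul_smul, inv_mul_cancel₀ h2.ne', one_smul]
  have hint1 := hlam.integrable_smul (shiftRight k s) (hlam.integrable_unitVolume g)
  have hint2 := hlam.integrable_smul (shiftRight k' s) (hlam.integrable_unitVolume f)
  rw [travelPairing_apply, travelPairing_apply, ← integral_sub hint1 hint2]
  have hint := (intervalIntegrable_iff_unitVolume _).2 (hint1.sub hint2).neg
  have key := (hkac.fun_smul hUac).integral_eq_sub_of_ae_hasDerivAt hint (by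
    have h1 := ae_unitVolume_iff.1 hlam.ae_hasDerivAt_travelTime
    have h2 := ae_unitVolume_iff.1 hf1
    have h3 := ae_unitVolume_iff.1 (hlam.ae_of_ae_weight hv)
    rw [← uIcc_of_le (zero_le_one' ℝ)] at h1 h2 h3
    filter_upwards [h1, h2, h3, hVI.ae_hasDerivAt_integral] with ζ h1 h2 h3 h4 hζ
    have d1 := (h (travelTime lam ζ - s)).scomp ζ ((h1 hζ).sub_const s)
    have d2 := (h4 hζ 0 left_mem_uIcc).const_add (u 0)
    refine (d1.smul d2).congr_deriv ?_
    have h5 := hUu ζ (by rwa [uIcc_of_le zero_le_one] at hζ)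
    simp only [Pi.neg_apply, Pi.sub_apply, shiftRight_apply, Function.comp_apply]
    rw [h2 hζ, h3 hζ, h5, smul_neg, neg_sub, sub_neg_eq_add, add_comm]
    congr 1
    rw [smul_assoc, smul_comm])
  rw [← integral_unitVolume] at key
  simp only [Pi.neg_def, integral_neg] at key
  rw [← neg_inj]
  refine key.trans ?_
  rw [← hUu 1 (by simp), ← hUu 0 (by simp), travelTime_zero, zero_sub, neg_sub]

end Pairing

/-! ### Differentiating a moving functional along an orbit -/

theorem hasDerivAt_of_norm_le_sq {E : Type*} [NormedAddCommGroup E] [NormedSpace ℂ E]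
    {l : ℝ → E} {l' : E} {C t : ℝ}
    (hl : ∀ r, ‖l r - l t + ((r - t : ℝ) : ℂ) • l'‖ ≤ C * (r - t) ^ 2) :
    HasDerivAt l (-l') t := by
  rw [hasDerivAt_iff_isLittleO]
  have h1 : (fun r => l r - l t - (r - t) • -l') =O[𝓝 t] fun r => (r - t) ^ 2 := by
    refine Asymptotics.IsBigO.of_bound C (Eventually.of_forall fun r => ?_)
    rw [smul_neg, sub_neg_eq_add, Real.norm_of_nonneg (sq_nonneg _), ← Complex.coe_smul]
    exact hl r
  refine h1.trans_isLittleO ?_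
  have h2 : (fun s : ℝ => s ^ 2) =o[𝓝 0] fun s => s ^ 1 :=
    Asymptotics.isLittleO_pow_pow one_lt_two
  have h3 : Tendsto (fun r : ℝ => r - t) (𝓝 t) (𝓝 0) :=
    (by fun_prop : Continuous fun r : ℝ => r - t).tendsto' _ _ (sub_self t)
  simpa [Function.comp_def] using h2.comp_tendsto h3

namespace C0Semigroup

theorem hasDerivWithinAt_clm_op {X E : Type*} [NormedAddCommGroup X] [NormedSpace ℂ X]
    [NormedAddCommGroup E] [NormedSpace ℂ E] (T : C0Semigroup X) {x y : X}
    (h : (x, y) ∈ T.generator.graph) {t : ℝ} (ht : 0 ≤ t) {l : ℝ → X →L[ℂ] E} {l' : X →L[ℂ] E}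
    {C : ℝ} (hl : ∀ r, ‖l r - l t + ((r - t : ℝ) : ℂ) • l'‖ ≤ C * (r - t) ^ 2) :
    HasDerivWithinAt (fun r : ℝ => l r (T.op r.toNNReal x))
      (l t (T.op t.toNNReal y) - l' (T.op t.toNNReal x)) (Ici t) t := by
  have hd : HasDerivAt l (-l') t := hasDerivAt_of_norm_le_sq hl
  let A : (X →L[ℂ] E) →L[ℝ] X →L[ℝ] E :=
    (ContinuousLinearMap.id ℂ (X →L[ℂ] E)).bilinearRestrictScalars ℝ
  have h1 := ((A.hasFDerivAt (x := l t)).comp_hasDerivAt t hd).hasDerivWithinAt.clm_apply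
    (T.hasDerivWithinAt_op h ht)
  refine h1.congr_deriv ?_
  change (-l') _ + l t _ = _
  simp only [neg_apply]
  abel

end C0Semigroup

/-! ### Test functions of the travel time separate states -/

section Separation

variable {lam : ℝ → ℝ} {n : ℕ}

theorem exists_boundedContinuous_derivs {φ : ℝ → ℝ} (h : ContDiff ℝ 2 φ)
    (hs : HasCompactSupport φ) :
    ∃ k k' k'' : ℝ →ᵇ ℂ, (∀ x, k x = φ x) ∧ (∀ x, HasDerivAt k (k' x) x) ∧
      ∀ x, HasDerivAt k' (k'' x) x := by
  have aux : ∀ ψ : ℝ → ℝ, Continuous ψ → HasCompactSupport ψ → ∃ k : ℝ →ᵇ ℂ, ∀ x, k x = ψ x := by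
    intro ψ hc hs
    obtain ⟨C, hC⟩ := hc.bounded_above_of_compact_support hs
    exact ⟨BoundedContinuousFunction.ofNormedAddCommGroup (fun x => (ψ x : ℂ)) (by fun_prop) C
      (fun x => by simpa using hC x), fun x => rfl⟩
  have h1 : ContDiff ℝ 1 (deriv φ) := ((contDiff_succ_iff_deriv (n := 1)).1 h).2.2
  have h2 : Continuous (deriv (deriv φ)) := (contDiff_one_iff_deriv.1 h1).2
  obtain ⟨k, hk⟩ := aux φ h.continuous hs
  obtain ⟨k', hk'⟩ := aux _ h1.continuous hs.deriv
  obtain ⟨k'', hk''⟩ := aux _ h2 hs.deriv.deriv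
  refine ⟨k, k', k'', hk, fun x => ?_, fun x => ?_⟩
  · rw [hk', funext hk]
    exact ((h.differentiable (by norm_num)) x).hasDerivAt.ofReal_comp
  · rw [hk'', funext hk']
    exact ((h1.differentiable one_ne_zero) x).hasDerivAt.ofReal_comp

/-- Smooth approximations of the indicator function of `(0, c)`. -/
noncomputable def smoothIndicator (c : ℝ) (j : ℕ) (x : ℝ) : ℝ :=
  Real.smoothTransition (j * x) * Real.smoothTransition (j * (c - x))

theorem contDiff_smoothIndicator (c : ℝ) (j : ℕ) : ContDiff ℝ 2 (smoothIndicator c j) := by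
  have h := Real.smoothTransition.contDiff (n := 2)
  exact (h.comp (by fun_prop : ContDiff ℝ 2 fun x : ℝ => (j : ℝ) * x)).mul
    (h.comp (by fun_prop : ContDiff ℝ 2 fun x : ℝ => (j : ℝ) * (c - x)))

theorem smoothIndicator_of_nonpos (c : ℝ) (j : ℕ) {x : ℝ} (hx : x ≤ 0) :
    smoothIndicator c j x = 0 := by
  rw [smoothIndicator, Real.smoothTransition.zero_of_nonpos
    (mul_nonpos_of_nonneg_of_nonpos (Nat.cast_nonneg j) hx), zero_mul]

theorem smoothIndicator_of_ge {c : ℝ} (j : ℕ) {x : ℝ} (hx : c ≤ x) :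
    smoothIndicator c j x = 0 := by
  rw [smoothIndicator, Real.smoothTransition.zero_of_nonpos (x := j * (c - x))
    (mul_nonpos_of_nonneg_of_nonpos (Nat.cast_nonneg j) (sub_nonpos.2 hx)), mul_zero]

theorem abs_smoothIndicator_le (c : ℝ) (j : ℕ) (x : ℝ) : |smoothIndicator c j x| ≤ 1 := by
  rw [smoothIndicator, abs_mul, abs_of_nonneg (Real.smoothTransition.nonneg _),
    abs_of_nonneg (Real.smoothTransition.nonneg _)]
  exact mul_le_one₀ (Real.smoothTransition.le_one _) (Real.smoothTransition.nonneg _)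
    (Real.smoothTransition.le_one _)

theorem hasCompactSupport_smoothIndicator (c : ℝ) (j : ℕ) :
    HasCompactSupport (smoothIndicator c j) := by
  refine HasCompactSupport.intro (isCompact_Icc (a := 0) (b := c)) fun x hx => ?_
  rcases le_total x 0 with h | h
  · exact smoothIndicator_of_nonpos c j h
  · exact smoothIndicator_of_ge j (le_of_not_ge fun h' => hx ⟨h, h'⟩)

theorem tendsto_smoothIndicator {c x : ℝ} (h0 : 0 < x) (hx : x < c) :
    Tendsto (fun j => smoothIndicator c j x) atTop (𝓝 1) := by
  have key : ∀ y : ℝ, 0 < y →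
      ∀ᶠ j : ℕ in atTop, Real.smoothTransition ((j : ℝ) * y) = 1 := fun y hy => by
    filter_upwards [(tendsto_natCast_atTop_atTop.atTop_mul_const hy).eventually_ge_atTop 1]
      with j hj using Real.smoothTransition.one_of_one_le hj
  refine tendsto_const_nhds.congr' ?_
  filter_upwards [key x h0, key (c - x) (sub_pos.2 hx)] with j h1 h2
  rw [smoothIndicator, h1, h2, one_mul]

/-- The travel pairing with smooth functions supported in `[0, τ(1)]` separates points. -/
theorem eq_zero_of_travelPairing_eq_zero (hlam : IsAdmissibleSpeed lam) (g : StateSpace n lam)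
    (hg : ∀ k k' k'' : ℝ →ᵇ ℂ, (∀ x, HasDerivAt k (k' x) x) → (∀ x, HasDerivAt k' (k'' x) x) →
      (∀ x ≤ 0, k x = 0) → (∀ x, travelTime lam 1 ≤ x → k x = 0) → travelPairing hlam k g = 0) :
    g = 0 := by
  have hgi := hlam.integrable_unitVolume g
  -- Since `τ` is strictly increasing, smooth approximations of the indicator of `(0, τ(b))`
  -- composed with `τ` converge to the indicator of `(0, b)`. Dominated convergence makes every
  -- primitive of `g` vanish, and differentiation then gives `g = 0`.
  have hprim : ∀ b ∈ Icc (0 : ℝ) 1, ∫ ζ in (0 : ℝ)..b, g ζ = 0 := by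
    intro b hb
    choose k k' k'' hk hkd hkd' using fun j => exists_boundedContinuous_derivs
      (contDiff_smoothIndicator (travelTime lam b) j)
      (hasCompactSupport_smoothIndicator (travelTime lam b) j)
    have hz : ∀ j, ∫ ζ, k j (travelTime lam ζ) • g ζ ∂unitVolume = 0 := fun j => by
      rw [← travelPairing_apply hlam]
      refine hg (k j) (k' j) (k'' j) (hkd j) (hkd' j) (fun x hx => ?_) fun x hx => ?_
      · rw [hk, smoothIndicator_of_nonpos _ _ hx, Complex.ofReal_zero]
      · rw [hk, smoothIndicator_of_ge _ ((hlam.travelTime_mem_Icc hb).2.trans hx),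
          Complex.ofReal_zero]
    have hlim : Tendsto (fun j => ∫ ζ, k j (travelTime lam ζ) • g ζ ∂unitVolume) atTop
        (𝓝 (∫ ζ, (Iio b).indicator g ζ ∂unitVolume)) := by
      refine tendsto_integral_of_dominated_convergence (fun ζ => ‖g ζ‖)
        (fun j => (hlam.integrable_smul (k j) hgi).1) hgi.norm (fun j => ae_of_all _ fun ζ => ?_) ?_
      · rw [norm_smul, hk, Complex.norm_real]
        exact mul_le_of_le_one_left (norm_nonneg _) (abs_smoothIndicator_le _ _ _)
      · rw [unitVolume, ae_restrict_iff' measurableSet_Ioo]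
        refine ae_of_all _ fun ζ hζ => ?_
        have hζ' := Ioo_subset_Icc_self hζ
        have hm := hlam.strictMonoOn_travelTime
        by_cases hζb : ζ < b
        · rw [indicator_of_mem (by exact hζb)]
          have h0 := hm (left_mem_Icc.2 zero_le_one) hζ' hζ.1
          rw [travelTime_zero] at h0
          have h1 := tendsto_smoothIndicator h0 (hm hζ' hb hζb)
          have h2 : Tendsto (fun j => k j (travelTime lam ζ)) atTop (𝓝 1) := by
            simp only [hk]
            simpa [Function.comp_def] using (Complex.continuous_ofReal.tendsto 1).comp h1
          simpa using h2.smul_const (g ζ)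
        · rw [indicator_of_notMem (by exact hζb)]
          refine tendsto_const_nhds.congr fun j => ?_
          rw [hk, smoothIndicator_of_ge _ (hm.monotoneOn hb hζ' (not_lt.1 hζb)),
            Complex.ofReal_zero, zero_smul]
    have h0 : ∫ ζ, (Iio b).indicator g ζ ∂unitVolume = 0 :=
      tendsto_nhds_unique hlim (by simpa only [hz] using tendsto_const_nhds)
    rw [integral_indicator measurableSet_Iio, unitVolume,
      Measure.restrict_restrict measurableSet_Iio] at h0
    have hset : Iio b ∩ Ioo 0 1 = Ioo 0 b := by
      ext ζ
      simp only [mem_inter_iff, mem_Iio, mem_Ioo]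
      constructor
      · rintro ⟨h1, h2, -⟩
        exact ⟨h2, h1⟩
      · rintro ⟨h1, h2⟩
        exact ⟨h2, h1, h2.trans_le hb.2⟩
    rw [hset] at h0
    rw [intervalIntegral.integral_of_le hb.1, integral_Ioc_eq_integral_Ioo]
    exact h0
  have hae : ∀ᵐ ζ ∂unitVolume, g ζ = 0 := by
    rw [unitVolume, ae_restrict_iff' measurableSet_Ioo]
    filter_upwards [((intervalIntegrable_iff_unitVolume _).2 hgi).ae_hasDerivAt_integral]
      with ζ hζ hmem
    have hd := hζ (by rw [uIcc_of_le zero_le_one]; exact Ioo_subset_Icc_self hmem) 0 left_mem_uIcc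
    refine hd.unique ((hasDerivAt_const ζ (0 : EuclideanSpace ℂ (Fin n))).congr_of_eventuallyEq ?_)
    filter_upwards [Ioo_mem_nhds hmem.1 hmem.2] with x hx
    exact hprim x (Ioo_subset_Icc_self hx)
  refine Lp.ext ?_
  filter_upwards [IsAdmissibleSpeed.ae_weight_of_ae hae,
    Lp.coeFn_zero (EuclideanSpace ℂ (Fin n)) 2 (weightMeasure lam)] with ζ h1 h2
  rw [h1, h2]
  rfl

end Separation

/-! ### The identity `K T(a) = -W` -/

section Shift

variable {lam : ℝ → ℝ} {n : ℕ}

/-- A matrix acting on `ℂⁿ`. -/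
noncomputable abbrev matrixCLM (A : Matrix (Fin n) (Fin n) ℂ) :
    EuclideanSpace ℂ (Fin n) →L[ℂ] EuclideanSpace ℂ (Fin n) :=
  Matrix.toEuclideanCLM (n := Fin n) (𝕜 := ℂ) A

/-- Pointwise application of a constant matrix on the state space. -/
noncomputable def pointwiseMul (lam : ℝ → ℝ) (A : Matrix (Fin n) (Fin n) ℂ) :
    StateSpace n lam →L[ℂ] StateSpace n lam :=
  (matrixCLM A).compLpL 2 (weightMeasure lam)

theorem coeFn_pointwiseMul (A : Matrix (Fin n) (Fin n) ℂ) (g : StateSpace n lam) :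
    pointwiseMul lam A g =ᵐ[weightMeasure lam] fun ζ => matrixCLM A (g ζ) :=
  (matrixCLM A).coeFn_compLpL g

theorem pointwiseMul_one : pointwiseMul lam (1 : Matrix (Fin n) (Fin n) ℂ) = 1 := by
  ext1 g
  refine Lp.ext ?_
  filter_upwards [coeFn_pointwiseMul 1 g] with ζ h
  rw [h, matrixCLM, map_one]
  rfl

theorem pointwiseMul_mul (A B : Matrix (Fin n) (Fin n) ℂ) :
    pointwiseMul lam (A * B) = pointwiseMul lam A * pointwiseMul lam B := by
  ext1 g
  refine Lp.ext ?_
  filter_upwards [coeFn_pointwiseMul (A * B) g, coeFn_pointwiseMul B g,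
    coeFn_pointwiseMul A (pointwiseMul lam B g)] with ζ h1 h2 h3
  rw [h1, ContinuousLinearMap.mul_def, ContinuousLinearMap.comp_apply, h3, h2, matrixCLM, map_mul]
  rfl

theorem travelPairing_pointwiseMul (hlam : IsAdmissibleSpeed lam) (k : ℝ →ᵇ ℂ)
    (A : Matrix (Fin n) (Fin n) ℂ) (g : StateSpace n lam) :
    travelPairing hlam k (pointwiseMul lam A g) = matrixCLM A (travelPairing hlam k g) := by
  rw [travelPairing_apply, travelPairing_apply, ← ContinuousLinearMap.integral_comp_comm _
    (hlam.integrable_smul k (hlam.integrable_unitVolume g))]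
  refine integral_congr_ae ?_
  filter_upwards [hlam.ae_of_ae_weight (coeFn_pointwiseMul A g)] with ζ h
  rw [h, map_smul]

theorem travelPairing_congr (hlam : IsAdmissibleSpeed lam) {k l : ℝ →ᵇ ℂ}
    (h : ∀ x ∈ Icc 0 (travelTime lam 1), k x = l x) (g : StateSpace n lam) :
    travelPairing hlam k g = travelPairing hlam l g := by
  rw [travelPairing_apply, travelPairing_apply]
  refine integral_congr_ae ?_
  rw [EventuallyEq, unitVolume, ae_restrict_iff' measurableSet_Ioo]
  refine ae_of_all _ fun ζ hζ => ?_
  rw [h _ (hlam.travelTime_mem_Icc (Ioo_subset_Icc_self hζ))]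

variable {K W : Matrix (Fin n) (Fin n) ℂ} {T : C0Semigroup (StateSpace n lam)}

/-- The profile `k` travels with the flow in two copies: the one weighted by `K` enters at `0`
during `[0, a]` while the one weighted by `W` leaves at `1`. The boundary condition balances the two
fluxes, so the difference of the pairings is conserved. -/
theorem matrixCLM_travelPairing_op_eq (hlam : IsAdmissibleSpeed lam)
    (hT : T.generator = transportOperator lam K W) {k k' k'' : ℝ →ᵇ ℂ}
    (h : ∀ x, HasDerivAt k (k' x) x) (h' : ∀ x, HasDerivAt k' (k'' x) x)
    (h0 : ∀ x ≤ 0, k x = 0) (h1 : ∀ x, travelTime lam 1 ≤ x → k x = 0)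
    {f g : StateSpace n lam} (hfg : (f, g) ∈ T.generator.graph) :
    matrixCLM K (travelPairing hlam k (T.op (travelTime lam 1).toNNReal f)) =
      - matrixCLM W (travelPairing hlam k f) := by
  set a := travelTime lam 1 with ha
  have ha0 : 0 < a := hlam.travelTime_one_pos
  have hl : ∀ c t r : ℝ, ‖travelPairing (n := n) hlam (shiftRight k (r - c)) -
      travelPairing hlam (shiftRight k (t - c)) +
      ((r - t : ℝ) : ℂ) • travelPairing hlam (shiftRight k' (t - c))‖ ≤
      ‖travelPairing (n := n) hlam‖ * ‖k''‖ * (r - t) ^ 2 := fun c t r => by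
    rw [← map_sub, ← map_smul, ← map_add, mul_assoc]
    have := norm_shiftRight_sub_le h h' (r - c) (t - c)
    rw [sub_sub_sub_cancel_right] at this
    exact (travelPairing hlam).le_opNorm_of_le this
  -- At `r = 0` the `K` copy lies outside `[0, a]`, and at `r = a` the `W` copy does; comparing the
  -- two times gives the claim. The shift `r - 0` lets `hl` serve both copies.
  have hconst := constant_of_has_deriv_right_zero (a := 0) (b := a)
    (f := fun r : ℝ => matrixCLM K (travelPairing hlam (shiftRight k (r - a)) (T.op r.toNNReal f)) -
      matrixCLM W (travelPairing hlam (shiftRight k (r - 0)) (T.op r.toNNReal f))) ?_ ?_ a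
      ⟨ha0.le, le_rfl⟩
  · simp only [sub_self, sub_zero, Real.toNNReal_zero, T.op_zero, zero_sub,
      ContinuousLinearMap.id_apply] at hconst
    have e1 : ∀ q : StateSpace n lam, travelPairing hlam (shiftRight k 0) q =
        travelPairing hlam k q := fun q => travelPairing_congr hlam (fun x _ => by
      rw [shiftRight_apply, sub_zero]) q
    have e2 : ∀ q : StateSpace n lam, travelPairing hlam (shiftRight k a) q = 0 := fun q => by
      rw [travelPairing_congr (k := shiftRight k a) (l := 0) hlam
        (fun x hx => h0 _ (sub_nonpos.2 hx.2)) q, map_zero]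
      rfl
    have e3 : ∀ q : StateSpace n lam, travelPairing hlam (shiftRight k (-a)) q = 0 := fun q => by
      rw [travelPairing_congr (k := shiftRight k (-a)) (l := 0) hlam
        (fun x hx => h1 _ (by
          change a ≤ x - -a
          linarith [hx.1])) q, map_zero]
      rfl
    rw [e1, e1, e2, e3, map_zero, map_zero, sub_zero, zero_sub] at hconst
    exact hconst
  · have hcont : ∀ c : ℝ, Continuous fun r : ℝ =>
        travelPairing hlam (shiftRight k (r - c)) (T.op r.toNNReal f) := fun c => by
      have hs : Continuous fun r : ℝ => travelPairing (n := n) hlam (shiftRight k (r - c)) := by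
        exact continuous_iff_continuousAt.2 fun t => (hasDerivAt_of_norm_le_sq (hl c t)).continuousAt
      exact hs.clm_apply (T.continuous_op_toNNReal f)
    exact (((matrixCLM K).continuous.comp (hcont a)).sub
      ((matrixCLM W).continuous.comp (hcont 0))).continuousOn
  · intro t ht
    have d : ∀ c, _ := fun c => T.hasDerivWithinAt_clm_op hfg ht.1 (hl c t)
    have hmem := T.mem_graph_generator_op hfg t.toNNReal
    rw [hT, mem_graph_transportOperator hlam] at hmem
    obtain ⟨u, v, huv, hu, hv, hb⟩ := hmem
    have hp := fun s => travelPairing_shiftRight_sub hlam h s huv hu hv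
    simp only [hp] at d
    have dK := ((matrixCLM K).restrictScalars ℝ).hasFDerivAt.comp_hasDerivWithinAt t (d a)
    have dW := ((matrixCLM W).restrictScalars ℝ).hasFDerivAt.comp_hasDerivWithinAt t (d 0)
    -- The support of `k` removes the terms `k(-t)` and `k(2a - t)`. What remains is `k(a - t)`
    -- times `K u(0) + W u(1)`, which vanishes.
    refine (dK.sub dW).congr_deriv ?_
    have hb' : matrixCLM K (u 0) + matrixCLM W (u 1) = 0 := by
      apply (WithLp.ofLp_injective 2)
      simpa using hb
    rw [ContinuousLinearMap.coe_restrictScalars', ContinuousLinearMap.coe_restrictScalars',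
      neg_sub, sub_zero, ← ha, h0 (-t) (by linarith [ht.1]), h1 (a - (t - a)) (by linarith [ht.2]),
      zero_smul, zero_smul, sub_zero, zero_sub, map_neg, map_smul, map_smul, sub_neg_eq_add,
      ← smul_add, hb', smul_zero]

/-- After the total travel time, the semigroup acts as a constant matrix relation. -/
theorem pointwiseMul_op_travelTime (hlam : IsAdmissibleSpeed lam)
    (hT : T.generator = transportOperator lam K W) :
    pointwiseMul lam K * T.op (travelTime lam 1).toNNReal = - pointwiseMul lam W := by
  refine ContinuousLinearMap.coeFn_injective ?_
  refine Continuous.ext_on T.dense_domain_generator (ContinuousLinearMap.continuous _)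
    (ContinuousLinearMap.continuous _) ?_
  rintro f ⟨g, hfg⟩
  rw [← sub_eq_zero]
  refine eq_zero_of_travelPairing_eq_zero hlam _ fun k k' k'' h h' h0 h1 => ?_
  rw [map_sub, sub_eq_zero, neg_apply, map_neg, ContinuousLinearMap.mul_def, ContinuousLinearMap.comp_apply,
    travelPairing_pointwiseMul, travelPairing_pointwiseMul]
  exact matrixCLM_travelPairing_op_eq hlam hT h h' h0 h1 hfg

end Shift

/-! ### Invertibility of `P(1)` -/

section FundamentalSolution

variable {lam : ℝ → ℝ} {n : ℕ}

/-- Gronwall's lemma for the primitive of `z`, which starts at `0` and whose derivative is at most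
`D` times itself. -/
theorem eq_zero_of_le_mul_integral {z : ℝ → ℝ} (hz : Continuous z) (h0 : ∀ x, 0 ≤ z x) {D : ℝ}
    (hD : ∀ x ∈ Icc (0 : ℝ) 1, z x ≤ D * ∫ s in (0 : ℝ)..x, z s) :
    ∀ x ∈ Icc (0 : ℝ) 1, z x = 0 := by
  have hd : ∀ x, HasDerivAt (fun x => ∫ s in (0 : ℝ)..x, z s) (z x) x := fun x =>
    (hz.integral_hasStrictDerivAt 0 x).hasDerivAt
  have hnn : ∀ x ∈ Icc (0 : ℝ) 1, 0 ≤ ∫ s in (0 : ℝ)..x, z s := fun x hx =>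
    intervalIntegral.integral_nonneg hx.1 fun s _ => h0 s
  have key := eq_zero_of_abs_deriv_le_mul_abs_self_of_eq_zero_right (K := D) (a := 0) (b := 1)
    (f := fun x => ∫ s in (0 : ℝ)..x, z s) (f' := z)
    (fun x _ => (hd x).continuousAt.continuousWithinAt) (fun x _ => (hd x).hasDerivWithinAt)
    (by simp) (fun x hx => by
      have hx' := Ico_subset_Icc_self hx
      rw [Real.norm_of_nonneg (h0 x), Real.norm_of_nonneg (hnn x hx')]
      exact hD x hx')
  intro x hx
  refine le_antisymm ?_ (h0 x)
  simpa [key x hx] using hD x hx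

/-- If `P(1) c = 0`, then `y = P c` solves the linear equation with final value zero. Gronwall
backwards from `1` gives `c = y(0) = 0`. -/
theorem IsFundamentalSolution.isUnit_apply_one {M P : ℝ → Matrix (Fin n) (Fin n) ℂ}
    (hP : IsFundamentalSolution lam M P) (hlam : IsAdmissibleSpeed lam)
    (hM : ∀ i j, MemLp (fun ζ => M ζ i j) ∞ unitVolume) : IsUnit (P 1) := by
  by_contra hnot
  rw [Matrix.isUnit_iff_isUnit_det, isUnit_iff_ne_zero, not_not] at hnot
  obtain ⟨c, hc, hPc⟩ := Matrix.exists_mulVec_eq_zero_iff.2 hnot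
  have hmem1 : (1 : ℝ) ∈ Icc (0 : ℝ) 1 := right_mem_Icc.2 zero_le_one
  have hmem0 : (0 : ℝ) ∈ Icc (0 : ℝ) 1 := left_mem_Icc.2 zero_le_one
  set y : ℝ → Fin n → ℂ := fun ζ => (P ζ).mulVec c with hy
  have hPc' : ∀ i j, ContinuousOn (fun ζ => P ζ i j) (Icc 0 1) := fun i j =>
    (continuous_id.matrix_elem i j).comp_continuousOn hP.continuousOn
  have hyc : ContinuousOn y (Icc 0 1) :=
    (continuous_id.matrix_mulVec continuous_const).comp_continuousOn hP.continuousOn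
  obtain ⟨C, hC, hCle⟩ := hlam.exists_inv_le
  have hMb : ∀ i j, ∀ᵐ ζ ∂unitVolume,
      ‖M ζ i j‖ ≤ (eLpNormEssSup (fun ζ => M ζ i j) unitVolume).toReal := fun i j => by
    have hfin : eLpNormEssSup (fun ζ => M ζ i j) unitVolume < ∞ := by simpa using (hM i j).2
    filter_upwards [ae_le_eLpNormEssSup (f := fun ζ => M ζ i j) (μ := unitVolume)] with ζ h1
    have := ENNReal.toReal_mono hfin.ne h1
    rwa [toReal_enorm] at this
  set B : Fin n → Fin n → ℝ := fun i j => (eLpNormEssSup (fun ζ => M ζ i j) unitVolume).toReal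
  have hB : ∀ i j, 0 ≤ B i j := fun i j => ENNReal.toReal_nonneg
  -- Summing the bounds of all entries of `M` dominates every row sum, hence the operator norm for
  -- the supremum norm on `ℂⁿ`.
  set D : ℝ := C * ∑ i, ∑ k, B i k with hD
  have hint : ∀ i j, IntervalIntegrable (fun s => ((lam s : ℂ))⁻¹ * (M s * P s) i j)
      volume 0 1 := fun i j => by
    have h1 : Integrable (fun s => (M s * P s) i j) unitVolume := by
      simp only [Matrix.mul_apply]
      refine integrable_finsetSum _ fun k _ => ?_
      rw [← intervalIntegrable_iff_unitVolume]
      refine IntervalIntegrable.mul_continuousOn ?_ (by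
        rw [uIcc_of_le zero_le_one]; exact hPc' k j)
      rw [intervalIntegrable_iff_unitVolume]
      exact (hM i k).integrable (by simp)
    rw [intervalIntegrable_iff_unitVolume]
    refine h1.bdd_mul (c := C) ?_ ?_
    · exact (Complex.measurable_ofReal.comp_aemeasurable
        hlam.memLp.1.aemeasurable).inv.aestronglyMeasurable
    · filter_upwards [hCle] with ζ h
      rw [← Complex.ofReal_inv, Complex.norm_real]
      exact h
  have hsub : ∀ ζ ∈ Icc (0 : ℝ) 1, uIcc ζ 1 ⊆ uIcc 0 1 := fun ζ hζ =>
    uIcc_subset_uIcc (by rwa [uIcc_of_le zero_le_one]) right_mem_uIcc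
  have hsub' : ∀ ζ ∈ Icc (0 : ℝ) 1, uIcc 0 ζ ⊆ uIcc 0 1 := fun ζ hζ =>
    uIcc_subset_uIcc left_mem_uIcc (by rwa [uIcc_of_le zero_le_one])
  have hynorm : ∀ ζ ∈ Icc (0 : ℝ) 1, IntervalIntegrable (fun s => ‖y s‖) volume ζ 1 :=
    fun ζ hζ => ContinuousOn.intervalIntegrable
      (hyc.norm.mono (by rw [← uIcc_of_le (zero_le_one' ℝ)]; exact hsub ζ hζ))
  have hbound : ∀ ζ ∈ Icc (0 : ℝ) 1, ‖y ζ‖ ≤ D * ∫ s in ζ..1, ‖y s‖ := by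
    intro ζ hζ
    have hnn : 0 ≤ ∫ s in ζ..1, ‖y s‖ :=
      intervalIntegral.integral_nonneg hζ.2 fun s _ => norm_nonneg _
    have hD0 : 0 ≤ D := mul_nonneg hC.le
      (Finset.sum_nonneg fun i _ => Finset.sum_nonneg fun k _ => hB i k)
    refine (pi_norm_le_iff_of_nonneg (mul_nonneg hD0 hnn)).2 fun i => ?_
    have hdiff : y ζ i = - ∫ s in ζ..1, ∑ j, ((lam s : ℂ))⁻¹ * (M s * P s) i j * c j := by
      rw [intervalIntegral.integral_finsetSum fun j _ =>
        ((hint i j).mono_set (hsub ζ hζ)).mul_const (c j)]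
      have h1 : y ζ i = y ζ i - y 1 i := by
        rw [show y 1 = 0 from hPc]; simp
      rw [h1]
      simp only [hy, Matrix.mulVec, dotProduct]
      rw [← Finset.sum_sub_distrib, ← Finset.sum_neg_distrib]
      refine Finset.sum_congr rfl fun j _ => ?_
      rw [intervalIntegral.integral_mul_const, ← sub_mul, hP.eq_integral ζ hζ,
        hP.eq_integral 1 hmem1, ← intervalIntegral.integral_interval_sub_left (hint i j)
          ((hint i j).mono_set (hsub' ζ hζ))]
      ring
    rw [hdiff, norm_neg, ← intervalIntegral.integral_const_mul]
    refine intervalIntegral.norm_integral_le_of_norm_le hζ.2 ?_ ((hynorm ζ hζ).const_mul D)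
    have hall := ae_unitVolume_iff.1 (hCle.and (ae_all_iff.2 fun k => hMb i k))
    filter_upwards [hall] with s hs hmem
    obtain ⟨h1, h2⟩ := hs ⟨hζ.1.trans hmem.1.le, hmem.2⟩
    have e : ∑ j, ((lam s : ℂ))⁻¹ * (M s * P s) i j * c j =
        ((lam s : ℂ))⁻¹ * ∑ k, M s i k * y s k := by
      have : ∑ k, M s i k * y s k = (M s * P s).mulVec c i := by
        rw [← Matrix.mulVec_mulVec]; rfl
      rw [this]
      simp only [Matrix.mulVec, dotProduct, Finset.mul_sum, mul_assoc]
    rw [e, norm_mul, ← Complex.ofReal_inv, Complex.norm_real, hD, mul_assoc, Finset.sum_mul]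
    refine mul_le_mul h1 ?_ (norm_nonneg _) hC.le
    have h3 : ‖∑ k, M s i k * y s k‖ ≤ (∑ k, B i k) * ‖y s‖ := by
      rw [Finset.sum_mul]
      refine norm_sum_le_of_le _ fun k _ => ?_
      rw [norm_mul]
      exact mul_le_mul (h2 k) (norm_le_pi_norm _ k) (norm_nonneg _) (hB i k)
    exact h3.trans (Finset.single_le_sum (f := fun i => (∑ k, B i k) * ‖y s‖)
      (fun i _ => mul_nonneg (Finset.sum_nonneg fun k _ => hB i k) (norm_nonneg _))
      (Finset.mem_univ i))
  -- Reflection `s ↦ 1 - s` turns the final value problem into an initial one; `projIcc` extends the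
  -- function continuously to the whole line.
  set z : ℝ → ℝ := fun s => ‖y (projIcc (0 : ℝ) 1 zero_le_one (1 - s))‖ with hz
  have hzeq : ∀ s ∈ Icc (0 : ℝ) 1, z s = ‖y (1 - s)‖ := fun s hs => by
    rw [hz]
    simp only
    rw [projIcc_of_mem zero_le_one (⟨by linarith [hs.2], by linarith [hs.1]⟩ :
      1 - s ∈ Icc (0 : ℝ) 1)]
  have hzc : Continuous z :=
    ((continuousOn_iff_continuous_domRestrict.1 hyc).comp
      (continuous_projIcc.comp (by fun_prop : Continuous fun s : ℝ => 1 - s))).norm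
  have hz0 := eq_zero_of_le_mul_integral (D := D) hzc (fun _ => norm_nonneg _) (fun x hx => by
    rw [hzeq x hx]
    refine (hbound (1 - x) ⟨by linarith [hx.2], by linarith [hx.1]⟩).trans (le_of_eq ?_)
    congr 1
    rw [intervalIntegral.integral_congr (g := fun s => ‖y (1 - s)‖) fun s hs => hzeq s (by
      rw [uIcc_of_le hx.1] at hs
      exact ⟨hs.1, hs.2.trans hx.2⟩)]
    have := intervalIntegral.integral_comp_sub_left (a := 0) (b := x) (fun s => ‖y s‖) 1
    rw [sub_zero] at this
    exact this.symm) 1 hmem1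
  rw [hzeq 1 hmem1, sub_self, norm_eq_zero] at hz0
  apply hc
  have hP0 : P 0 = 1 := by
    ext i j
    rw [hP.eq_integral 0 hmem0 i j, intervalIntegral.integral_same, add_zero]
  rw [hy] at hz0
  simpa [hP0] using hz0

end FundamentalSolution

/-! ### Eigenvectors and invertibility of `K` -/

section Boundary

variable {lam : ℝ → ℝ} {n : ℕ}

theorem IsAdmissibleSpeed.isFiniteMeasure_weightMeasure (hlam : IsAdmissibleSpeed lam) :
    IsFiniteMeasure (weightMeasure lam) :=
  isFiniteMeasure_withDensity_ofReal (hlam.memLp.integrable (by simp)).2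

theorem IsAdmissibleSpeed.exists_of_ae_weight (hlam : IsAdmissibleSpeed lam) {p : ℝ → Prop}
    (h : ∀ᵐ ζ ∂weightMeasure lam, p ζ) : ∃ ζ, p ζ :=
  (hlam.ae_of_ae_weight h).exists

/-- A function bounded and measurable with respect to Lebesgue measure represents a state. -/
theorem IsAdmissibleSpeed.exists_state (hlam : IsAdmissibleSpeed lam)
    {f : ℝ → EuclideanSpace ℂ (Fin n)} (hf : AEStronglyMeasurable f unitVolume) {C : ℝ}
    (hC : ∀ᵐ ζ ∂unitVolume, ‖f ζ‖ ≤ C) :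
    ∃ g : StateSpace n lam, ∀ᵐ ζ ∂weightMeasure lam, g ζ = f ζ := by
  have := hlam.isFiniteMeasure_weightMeasure
  have h : MemLp f 2 (weightMeasure lam) :=
    MemLp.of_bound (hf.mono_ac (withDensity_absolutelyContinuous _ _)) C
      (IsAdmissibleSpeed.ae_weight_of_ae hC)
  exact ⟨h.toLp f, h.coeFn_toLp⟩

theorem IsAdmissibleSpeed.exists_const_state (hlam : IsAdmissibleSpeed lam)
    (c : EuclideanSpace ℂ (Fin n)) :
    ∃ g : StateSpace n lam, ∀ᵐ ζ ∂weightMeasure lam, g ζ = c :=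
  hlam.exists_state aestronglyMeasurable_const (ae_of_all _ fun _ => le_rfl)

variable {K W : Matrix (Fin n) (Fin n) ℂ} {T : C0Semigroup (StateSpace n lam)}

/-- If the boundary matrix `K + e^{-sτ} W` is singular, then `s` is an eigenvalue. -/
theorem exists_eigenvector (hlam : IsAdmissibleSpeed lam) {s : ℝ}
    {c : EuclideanSpace ℂ (Fin n)} (hc : c ≠ 0)
    (hKW : matrixCLM K c + (Real.exp (-(s * travelTime lam 1)) : ℂ) • matrixCLM W c = 0) :
    ∃ f : StateSpace n lam, f ≠ 0 ∧ (f, (s : ℂ) • f) ∈ (transportOperator lam K W).graph := by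
  obtain ⟨C, hC, hCle⟩ := hlam.exists_inv_le
  -- The solution of `-(lam f)' = s f` with `(lam f)(0) = c` is `lam f = exp(-s τ) c`; `hKW` is its
  -- boundary condition.
  set e : ℝ → ℝ := fun ζ => Real.exp (-(s * travelTime lam ζ)) with he
  have hec : ContinuousOn e (Icc 0 1) :=
    (by fun_prop : Continuous fun x : ℝ => Real.exp (-(s * x))).comp_continuousOn
      hlam.continuousOn_travelTime
  obtain ⟨B, hB⟩ := isCompact_Icc.exists_bound_of_continuousOn hec
  have hem : AEStronglyMeasurable e unitVolume :=
    hlam.aestronglyMeasurable_comp_travelTime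
      (by fun_prop : Continuous fun x : ℝ => Real.exp (-(s * x)))
  have hfm : AEStronglyMeasurable (fun ζ => ((lam ζ)⁻¹ * e ζ) • c) unitVolume :=
    (hlam.aestronglyMeasurable_inv.mul hem).smul_const c
  have hfb : ∀ᵐ ζ ∂unitVolume, ‖((lam ζ)⁻¹ * e ζ) • c‖ ≤ C * B * ‖c‖ := by
    filter_upwards [hCle, ae_unitVolume_iff.2 (ae_of_all _ hB)] with ζ h1 h2
    rw [norm_smul, norm_mul]
    gcongr
  obtain ⟨f, hf⟩ := hlam.exists_state hfm hfb
  have hpos := hlam.ae_pos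
  refine ⟨f, ?_, ?_⟩
  · rintro rfl
    obtain ⟨ζ, h1, h2, h3⟩ := ((hlam.ae_of_ae_weight hf).and ((hlam.ae_of_ae_weight
      (Lp.coeFn_zero (EuclideanSpace ℂ (Fin n)) 2 (weightMeasure lam))).and hpos)).exists
    rw [h2, Pi.zero_apply, eq_comm, smul_eq_zero] at h1
    rcases h1 with h1 | h1
    · exact (mul_pos (inv_pos.2 h3) (Real.exp_pos _)).ne' h1
    · exact hc h1
  · rw [mem_graph_transportOperator hlam]
    have hvb : ∀ᵐ ζ ∂unitVolume, ‖-s • ((lam ζ)⁻¹ * e ζ) • c‖ ≤ ‖-s‖ * (C * B * ‖c‖) := by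
      filter_upwards [hfb] with ζ h
      rw [norm_smul]
      gcongr
    have hv : MemLp (fun ζ => -s • ((lam ζ)⁻¹ * e ζ) • c) 2 unitVolume :=
      MemLp.of_bound (hfm.const_smul (-s)) _ hvb
    have hvi := (intervalIntegrable_iff_unitVolume _).2 (hv.integrable one_le_two)
    refine ⟨fun ζ => e ζ • c, fun ζ => -s • ((lam ζ)⁻¹ * e ζ) • c, ⟨hv, ?_⟩, ?_, ?_, ?_⟩
    · intro ζ hζ
      have hsub : uIcc 0 ζ ⊆ Icc (0 : ℝ) 1 := by
        rw [uIcc_of_le hζ.1]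
        exact Icc_subset_Icc_right hζ.2
      have hac : AbsolutelyContinuousOnInterval (fun ζ => e ζ • c) 0 ζ := by
        obtain ⟨L, hL⟩ := hlam.exists_lipschitzOnWith_travelTime
        obtain ⟨R, hR⟩ := ContDiffOn.exists_lipschitzOnWith (n := 1)
          (f := fun x : ℝ => Real.exp (-(s * x)) • c) (s := Icc 0 (travelTime lam 1))
          (ContDiff.contDiffOn (by fun_prop)) one_ne_zero (convex_Icc _ _) isCompact_Icc
        exact LipschitzOnWith.absolutelyContinuousOnInterval
          ((hR.comp hL fun x hx => hlam.travelTime_mem_Icc hx).mono hsub)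
      have key := hac.integral_eq_sub_of_ae_hasDerivAt
        (hvi.mono_set (by rwa [uIcc_of_le (zero_le_one' ℝ)])) (by
          filter_upwards [ae_unitVolume_iff.1 hlam.ae_hasDerivAt_travelTime] with x hx hmem
          have h1 := (((hx (hsub hmem)).const_mul s).neg.exp).smul_const c
          refine h1.congr_deriv ?_
          rw [smul_smul]
          congr 1
          simp only [he, Pi.neg_apply]
          ring)
      rw [key]
      abel
    · filter_upwards [hf, IsAdmissibleSpeed.ae_weight_of_ae hpos] with ζ h1 h2
      rw [h1, Complex.coe_smul, smul_smul, ← mul_assoc, mul_inv_cancel₀ h2.ne', one_mul]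
    · filter_upwards [hf, Lp.coeFn_smul (s : ℂ) f] with ζ h1 h2
      rw [h2, Pi.smul_apply, h1, neg_smul, neg_neg, Complex.coe_smul]
    · have h0 : e 0 = 1 := by simp [he]
      have := congrArg WithLp.ofLp hKW
      simp only [h0, one_smul, ← Complex.coe_smul (e 1), WithLp.ofLp_smul, Matrix.mulVec_smul]
      simpa [he] using this

/-- A singular `K` would make every real number an eigenvalue of the generator, contradicting the
boundedness of `T(a)`. -/
theorem isUnit_left_boundary_matrix (hlam : IsAdmissibleSpeed lam)
    (hT : T.generator = transportOperator lam K W) : IsUnit K := by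
  by_contra hnot
  rw [Matrix.isUnit_iff_isUnit_det, isUnit_iff_ne_zero, not_not] at hnot
  obtain ⟨r, hr, hrK⟩ := Matrix.exists_vecMul_eq_zero_iff.2 hnot
  set a := (travelTime lam 1).toNNReal with ha
  -- Apply `r` to `K T(a) g = -W g` for constant states `g`, evaluated at a single point of the
  -- full-measure set where the representatives agree.
  have hrW : Matrix.vecMul r W = 0 := by
    refine dotProduct_eq_zero _ fun c => ?_
    obtain ⟨g, hg⟩ := hlam.exists_const_state (WithLp.toLp 2 c)
    have hrel := congrArg (fun S : StateSpace n lam →L[ℂ] StateSpace n lam => S g)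
      (pointwiseMul_op_travelTime hlam hT)
    simp only [ContinuousLinearMap.mul_def, ContinuousLinearMap.comp_apply, neg_apply] at hrel
    have hae := coeFn_pointwiseMul K (T.op a g)
    rw [hrel] at hae
    obtain ⟨ζ, h1, h2, h3, h4⟩ := hlam.exists_of_ae_weight (hg.and (hae.and
      ((coeFn_pointwiseMul W g).and (Lp.coeFn_neg (pointwiseMul lam W g)))))
    simp only [h4, Pi.neg_apply, h3, h1] at h2
    have h5 := congrArg WithLp.ofLp h2
    simp only [WithLp.ofLp_neg, Matrix.ofLp_toEuclideanCLM] at h5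
    rw [← Matrix.dotProduct_mulVec, ← neg_neg (W.mulVec c), h5, dotProduct_neg,
      Matrix.dotProduct_mulVec, hrK, zero_dotProduct, neg_zero]
  have hcoe : (a : ℝ) = travelTime lam 1 := Real.coe_toNNReal _ hlam.travelTime_one_pos.le
  have hexp : ∀ s : ℝ, Real.exp (s * a) ≤ ‖T.op a‖ := by
    intro s
    set z : ℂ := (Real.exp (-(s * travelTime lam 1)) : ℂ) with hz
    have hdet : (K + z • W).det = 0 := Matrix.exists_vecMul_eq_zero_iff.1
      ⟨r, hr, by rw [Matrix.vecMul_add, Matrix.vecMul_smul, hrK, hrW, smul_zero, add_zero]⟩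
    obtain ⟨c, hc, hKWc⟩ := Matrix.exists_mulVec_eq_zero_iff.2 hdet
    rw [Matrix.add_mulVec, Matrix.smul_mulVec] at hKWc
    obtain ⟨f, hf, hfg⟩ := exists_eigenvector (K := K) (W := W) (s := s) hlam
      (c := WithLp.toLp 2 c) (by simpa using hc) (by
        apply WithLp.ofLp_injective 2
        simpa [hz] using hKWc)
    rw [← hT] at hfg
    have h1 := T.op_apply_eq_exp_smul hfg a
    have h2 := (T.op a).le_opNorm f
    rw [h1, norm_smul, Complex.norm_real, Real.norm_of_nonneg (Real.exp_pos _).le] at h2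
    exact le_of_mul_le_mul_right h2 (norm_pos_iff.2 hf)
  have hapos : (0 : ℝ) < a := hcoe ▸ hlam.travelTime_one_pos
  -- With `N = ‖T(a)‖` and `s = N / a` the bound reads `exp N ≤ N`, against `N + 1 ≤ exp N`.
  have h1 := hexp (‖T.op a‖ / a)
  rw [div_mul_cancel₀ _ hapos.ne'] at h1
  linarith [Real.add_one_le_exp ‖T.op a‖]

end Boundary

/-! ### The characterisation of groups -/

theorem mainTheorem4 {n : ℕ} (lam : ℝ → ℝ) (M P : ℝ → Matrix (Fin n) (Fin n) ℂ)
    (K L : Matrix (Fin n) (Fin n) ℂ)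
    (hlam : IsAdmissibleSpeed lam)
    (hM : ∀ i j, MemLp (fun ζ => M ζ i j) ∞ unitVolume)
    (hP : IsFundamentalSolution lam M P)
    (T : C0Semigroup (StateSpace n lam))
    (hT : T.generator = transportOperator lam K (L * P 1)) :
    T.ExtendsToGroup ↔ IsUnit L := by
  have hK : IsUnit K := isUnit_left_boundary_matrix hlam hT
  have hP1 : IsUnit (P 1) := hP.isUnit_apply_one hlam hM
  have hLP : IsUnit (L * P 1) ↔ IsUnit L := by
    simp only [Matrix.isUnit_iff_isUnit_det, IsUnit.mul_iff] at hP1 ⊢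
    exact and_iff_left hP1
  rw [← hLP]
  set W := L * P 1
  set a := (travelTime lam 1).toNNReal with ha
  have hrel : pointwiseMul lam K * T.op a = - pointwiseMul lam W :=
    pointwiseMul_op_travelTime hlam hT
  have hunit : ∀ A : Matrix (Fin n) (Fin n) ℂ, IsUnit A → IsUnit (pointwiseMul lam A) := by
    rintro _ ⟨A, rfl⟩
    exact ⟨⟨pointwiseMul lam A.1, pointwiseMul lam A.2, by
      rw [← pointwiseMul_mul, A.val_inv, pointwiseMul_one], by
      rw [← pointwiseMul_mul, A.inv_val, pointwiseMul_one]⟩, rfl⟩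
  constructor
  · intro h
    by_contra hnot
    rw [Matrix.isUnit_iff_isUnit_det, isUnit_iff_ne_zero, not_not] at hnot
    obtain ⟨c, hc, hWc⟩ := Matrix.exists_mulVec_eq_zero_iff.2 hnot
    -- The constant state with value `c` is a nonzero element of the kernel of `T(a)`.
    obtain ⟨g, hg⟩ := hlam.exists_const_state (WithLp.toLp 2 c)
    have hWg : pointwiseMul lam W g = 0 := by
      refine Lp.ext ?_
      filter_upwards [coeFn_pointwiseMul W g, hg, Lp.coeFn_zero (EuclideanSpace ℂ (Fin n)) 2
        (weightMeasure lam)] with ζ h1 h2 h3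
      rw [h1, h2, h3]
      apply WithLp.ofLp_injective 2
      simpa using hWc
    have hKT : pointwiseMul lam K (T.op a g) = 0 := by
      change (pointwiseMul lam K * T.op a) g = 0
      rw [hrel, neg_apply, hWg, neg_zero]
    obtain ⟨S, hS⟩ := (hunit K hK).exists_left_inv
    have hTg : T.op a g = 0 := by
      have := congrArg (fun R : StateSpace n lam →L[ℂ] StateSpace n lam => R (T.op a g)) hS
      simp only [ContinuousLinearMap.mul_def, ContinuousLinearMap.comp_apply, hKT, map_zero] at this
      exact this.symm
    have hg0 : g = 0 := h.injective a (by rw [hTg, map_zero])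
    obtain ⟨ζ, h1, h2⟩ := hlam.exists_of_ae_weight (hg.and
      (Lp.coeFn_zero (EuclideanSpace ℂ (Fin n)) 2 (weightMeasure lam)))
    rw [hg0, h2, Pi.zero_apply] at h1
    exact hc (by simpa using h1.symm)
  · intro hW
    refine T.extendsToGroup_of_isUnit (Real.toNNReal_pos.2 hlam.travelTime_one_pos) ?_
    obtain ⟨S, hS⟩ := hunit K hK
    rw [← hS] at hrel
    -- `T(a) = K⁻¹ (K T(a)) = K⁻¹ (-W)` is a product of invertible operators.
    rw [← S.inv_mul_cancel_left (T.op a), hrel]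
    exact S⁻¹.isUnit.mul (hunit W hW).neg
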